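/- Let $(X_t)_{t\in\mathbb R}$ be a complex-valued Gaussian process on a probability space $(Q,\Sigma,\mu)$ (all finite-dimensional distributions are Gaussian measures on the real vector spaces $\mathbb C^F$) with $\mathbb E(X_t)=0$ for all $t$ and $X_0=0$ almost surely. Assume that it has stationary quadratic increments, i.e. for all $t_0,s,t\in\mathbb R$ the quantity $$\mathbb E\big(\overline{(X_{g+s}-X_{g+t_0})}\,(X_{g+t}-X_{g+t_0})\big)$$ does not depend on $g\in\mathbb R$, and that $t\mapsto \mathbb E(|X_t|^2)$ is continuous. For $t,u\in\mathbb R$ let $$e_t(u)=\int_0^t e^{i\tau u}\,d\tau=\frac{e^{itu}-1}{iu}\quad(u\neq0),\qquad e_t(0)=t.$$ (1) There exists a unique Borel measure $\sigma$ on $\mathbb R$ such that, for all $s,t\in\mathbb R$, the function $\overline{e_s}e_t$ is $\sigma$-integrable and $$\mathbb E(\overline{X_s}X_t)=C_\sigma(s,t):=\int_{\mathbb R}\overline{e_s(u)}\,e_t(u)\,d\sigma(u).$$ (2) A Borel measure $\sigma$ on $\mathbb R$ arises in this way from such a process (on some probability space) if and only if $\int_{\mathbb R}\frac{d\sigma(u)}{1+u^2}<\infty$.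 (3) Let $\sigma$ be a Borel measure on $\mathbb R$ with $\int_{\mathbb R}\frac{d\sigma(u)}{1+u^2}<\infty$. Then for all $t\in\mathbb R$ the integral $$r(t):=\int_{\mathbb R}\Big(1-e^{itu}+\frac{itu}{1+u^2}\Big)\frac{d\sigma(u)}{u^2}$$ exists, where the integrand is given at $u=0$ its limit value $t^2/2$. The function $r$ is continuous and negative definite, meaning that $r(-t)=\overline{r(t)}$ and $\sum_{j,k}c_j\overline{c_k}\,r(x_j-x_k)\le 0$ for all $x_1,\dots,x_n\in\mathbb R$ and $c_1,\dots,c_n\in\mathbb C$ with $\sum_j c_j=0$. It satisfies $$r(t)+\overline{r(s)}-r(t-s)=C_\sigma(s,t)\qquad\text{for all } s,t\in\mathbb R.$$ Every continuous negative definite function $\tilde r:\mathbb R\to\mathbb C$ satisfying this relation is of the form $\tilde r(t)=r(t)+it\mu$ for some $\mu\in\mathbb R$. -/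

import Mathlib

open MeasureTheory ProbabilityTheory
open scoped ComplexOrder ComplexConjugate

universe u

noncomputable section

namespace LevyKhintchine

/-- A kernel `Q` on a set is hermitian if `Q x y = conj (Q y x)`. -/
def IsHermitianKernel {X : Type*} (Q : X → X → ℂ) : Prop :=
  ∀ x y, Q x y = conj (Q y x)

/-- A hermitian kernel is negative definite if `∑ⱼₖ cⱼ conj(cₖ) Q(xⱼ, xₖ) ≤ 0` whenever
`∑ⱼ cⱼ = 0`. (The order on `ℂ` is the usual partial one: `z ≤ 0` says that `z` is real and
nonpositive.) -/
def IsNegDefKernel {X : Type*} (Q : X → X → ℂ) : Prop :=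
  IsHermitianKernel Q ∧
    ∀ (n : ℕ) (x : Fin n → X) (c : Fin n → ℂ), ∑ j, c j = 0 →
      ∑ j, ∑ k, c j * conj (c k) * Q (x j) (x k) ≤ 0

/-- A function on an additive group is negative definite if the kernel
`(s, t) ↦ φ (s - t)` is negative definite. -/
def IsNegDefFun {G : Type*} [AddGroup G] (φ : G → ℂ) : Prop :=
  IsNegDefKernel fun s t => φ (s - t)

/-- `cov P X s t = E(conj(X_s) X_t)`. -/
def cov {Ω : Type*} [MeasurableSpace Ω] (P : Measure Ω) (X : ℝ → Ω → ℂ) (s t : ℝ) : ℂ :=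
  ∫ ω, conj (X s ω) * X t ω ∂P

/-- Stationary quadratic increments: for every `t₀`, the covariances of the increments
`X_s - X_{t₀}` and `X_t - X_{t₀}` do not change under a common time shift `g`. -/
def HasStationaryQuadraticIncrements {Ω : Type*} [MeasurableSpace Ω] (P : Measure Ω)
    (X : ℝ → Ω → ℂ) : Prop :=
  ∀ t₀ g s t : ℝ,
    ∫ ω, conj (X (g + s) ω - X (g + t₀) ω) * (X (g + t) ω - X (g + t₀) ω) ∂P =
      ∫ ω, conj (X s ω - X t₀ ω) * (X t ω - X t₀ ω) ∂P

/-- Complex-valued centered Gaussian processes `(X_t)_{t ∈ ℝ}` with `X₀ = 0` almost surely,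
stationary quadratic increments, and continuous second moment `t ↦ E|X_t|²`. "Gaussian" means
that all finite-dimensional distributions are Gaussian measures on the real vector
spaces `ℂ^F`. -/
structure IsAdmissibleProcess {Ω : Type*} [MeasurableSpace Ω] (P : Measure Ω)
    (X : ℝ → Ω → ℂ) : Prop where
  measurable : ∀ t, Measurable (X t)
  gaussian : IsGaussianProcess X P
  centered : ∀ t, ∫ ω, X t ω ∂P = 0
  zero : ∀ᵐ ω ∂P, X 0 ω = 0
  stationary : HasStationaryQuadraticIncrements P X
  continuous : Continuous fun t => ∫ ω, ‖X t ω‖ ^ 2 ∂P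

/-- `e_t(u) = (exp(itu) - 1) / (iu)`, with the continuous extension `e_t(0) = t`. -/
def e (t u : ℝ) : ℂ :=
  if u = 0 then (t : ℂ)
  else (Complex.exp (Complex.I * t * u) - 1) / (Complex.I * u)

/-- `e_t(u) = ∫₀ᵗ exp(iτu) dτ` for all real `t` and `u`. -/
theorem e_eq_integral (t u : ℝ) :
    e t u = ∫ τ in (0 : ℝ)..t, Complex.exp (Complex.I * τ * u) := by
  by_cases hu : u = 0
  · simp [e, hu]
  · have hc : Complex.I * (u : ℂ) ≠ 0 :=
      mul_ne_zero Complex.I_ne_zero (Complex.ofReal_ne_zero.mpr hu)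
    have h := integral_exp_mul_complex (a := 0) (b := t) hc
    have h2 : ∀ τ : ℝ, Complex.exp (Complex.I * τ * u) = Complex.exp (Complex.I * u * τ) :=
      fun τ => by ring_nf
    simp only [h2]
    rw [h]
    simp [e, hu, h2]

/-- `kernelOf σ s t = C_σ(s,t) = ∫ conj(e_s) e_t dσ`. -/
def kernelOf (σ : Measure ℝ) (s t : ℝ) : ℂ :=
  ∫ u, conj (e s u) * e t u ∂σ

/-- The Borel measure `σ` is a spectral measure of the process `X`: all the integrals
`∫ conj(e_s) e_t dσ` exist and they are the covariances of `X`. -/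
def IsSpectralMeasure {Ω : Type*} [MeasurableSpace Ω] (P : Measure Ω)
    (X : ℝ → Ω → ℂ) (σ : Measure ℝ) : Prop :=
  ∀ s t : ℝ, Integrable (fun u => conj (e s u) * e t u) σ ∧ cov P X s t = kernelOf σ s t

/-- The integrand `(1 - exp(itu) + itu / (1 + u²)) / u²`, with its limit `t² / 2` as value
at `u = 0`. -/
def rIntegrand (t u : ℝ) : ℂ :=
  if u = 0 then (t : ℂ) ^ 2 / 2
  else (1 - Complex.exp (Complex.I * t * u) + Complex.I * t * u / (1 + (u : ℂ) ^ 2)) /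
    (u : ℂ) ^ 2

/-- `r(t) = ∫ (1 - exp(itu) + itu / (1 + u²)) dσ(u) / u²`. -/
def r (σ : Measure ℝ) (t : ℝ) : ℂ :=
  ∫ u, rIntegrand t u ∂σ

/-- The relation `ρ(t) + conj(ρ(s)) - ρ(t - s) = C_σ(s,t)` for all `s` and `t`. -/
def SatisfiesRelation (σ : Measure ℝ) (ρ : ℝ → ℂ) : Prop :=
  ∀ s t : ℝ, ρ t + conj (ρ s) - ρ (t - s) = kernelOf σ s t

/-- The condition `∫ dσ(u) / (1 + u²) < ∞`. -/
def FiniteCondition (σ : Measure ℝ) : Prop :=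
  ∫⁻ u, ENNReal.ofReal (1 / (1 + u ^ 2)) ∂σ < ⊤

end LevyKhintchine

end

/-! View the process as a curve `x` in `L²(P)`. Stationarity makes inner products of increments
translation invariant, and continuity of the second moment makes `x` continuous. The smoothed curve
`z = stationaryPart x` is genuinely stationary and determines `x` through `x_t = z_t - z_0 + ∫₀ᵗ z`
(`eq_stationaryPart_add_integral`). Bochner's theorem (`exists_charFun_eq_of_inner_eq`) gives a
finite measure `ν` for which `z_t` corresponds to `exp(itu)` in `L²(ν)`. Then `x_t` corresponds to
`exp(itu) - 1 + e_t = (1 + iu) e_t`, so `σ = (1 + u²) ν` is a spectral measure.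

Uniqueness (`eq_of_kernelOf_eq`): `C_σ` determines the characteristic function of each finite
measure `|e_a|² σ`, and `e_1`, `e_√2` have no common zero, so the density can be divided out.

Conversely, if `∫ dσ/(1 + u²) < ∞`, then every `e_t` lies in `L²(σ)`. An isometry of this space into
a Gaussian space (`exists_gaussian_isometry`) carries the curve `t ↦ e_t` to the required process.

For `r`, the relation already holds for the integrands (`rIntegrand_relation`). It exhibits the
quadratic form of `r` as minus an integral of squares. Two continuous solutions differ by a
continuous additive function with imaginary values. -/

open Filter Topology FourierTransform
open scoped InnerProductSpace

/-! ### Bochner's theorem for stationary curves in a Hilbert space. -/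

section Bochner

variable {H : Type*} [NormedAddCommGroup H] [InnerProductSpace ℂ H]

theorem norm_eq_of_inner_eq {z : ℝ → H} {φ : ℝ → ℂ}
    (h : ∀ s t, ⟪z s, z t⟫_ℂ = φ (t - s)) (t : ℝ) : ‖z t‖ = ‖z 0‖ := by
  have h1 : (‖z t‖ : ℂ) ^ 2 = (‖z 0‖ : ℂ) ^ 2 := by
    have h2 := inner_self_eq_norm_sq_to_K (𝕜 := ℂ) (z t)
    have h3 := inner_self_eq_norm_sq_to_K (𝕜 := ℂ) (z 0)
    rw [h, sub_self] at h2 h3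
    exact h2.symm.trans h3
  have h4 : ‖z t‖ ^ 2 = ‖z 0‖ ^ 2 := by exact_mod_cast h1
  exact (sq_eq_sq₀ (norm_nonneg _) (norm_nonneg _)).1 h4

theorem norm_le_of_inner_eq {z : ℝ → H} {φ : ℝ → ℂ}
    (h : ∀ s t, ⟪z s, z t⟫_ℂ = φ (t - s)) (t : ℝ) : ‖φ t‖ ≤ ‖z 0‖ ^ 2 := by
  have h1 := norm_inner_le_norm (𝕜 := ℂ) (z 0) (z t)
  rwa [h, sub_zero, norm_eq_of_inner_eq h t, ← sq] at h1

theorem continuous_of_inner_eq {z : ℝ → H} {φ : ℝ → ℂ} (hz : Continuous z)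
    (h : ∀ s t, ⟪z s, z t⟫_ℂ = φ (t - s)) : Continuous φ := by
  have h1 : φ = fun t => ⟪z 0, z t⟫_ℂ := by ext t; simp [h]
  rw [h1]; fun_prop

theorem integrable_gaussian_mul {φ : ℝ → ℂ} {C : ℝ} (hφ : Continuous φ) (hC : ∀ t, ‖φ t‖ ≤ C)
    {b : ℝ} (hb : 0 < b) : Integrable fun v : ℝ => (Real.exp (-b * v ^ 2) : ℂ) * φ v := by
  refine Integrable.mono' ((integrable_exp_neg_mul_sq hb).mul_const C)
    (by fun_prop) (ae_of_all _ fun v => ?_)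
  rw [norm_mul, Complex.norm_real, Real.norm_of_nonneg (Real.exp_pos _).le]
  exact mul_le_mul_of_nonneg_left (hC v) (Real.exp_pos _).le

/-- Up to a positive constant the transform is `‖∫ F‖²` for a Gaussian-damped, modulated copy `F` of
`z`: in `⟪F s, F (s + v)⟫` the square is completed, and `s` is integrated out. -/
theorem fourier_gaussian_mul_nonneg [CompleteSpace H] {z : ℝ → H} {φ : ℝ → ℂ} (hz : Continuous z)
    (h : ∀ s t, ⟪z s, z t⟫_ℂ = φ (t - s)) {b : ℝ} (hb : 0 < b) (u : ℝ) :
    0 ≤ 𝓕 (fun v : ℝ => (Real.exp (-b * v ^ 2) : ℂ) * φ v) u := by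
  have hφ := continuous_of_inner_eq hz h
  have hφb := norm_le_of_inner_eq h
  let χ : ℝ → ℂ := fun s => Complex.exp ((-2 * Real.pi * (s * u) : ℝ) * Complex.I)
  have hχ : Continuous χ := by simp only [χ]; fun_prop
  have hχn : ∀ s, ‖χ s‖ = 1 := fun s => Complex.norm_exp_ofReal_mul_I _
  let F : ℝ → H := fun s => ((Real.exp (-(2 * b) * s ^ 2) : ℂ) * χ s) • z s
  have hF : Integrable F := by
    refine Integrable.mono' ((integrable_exp_neg_mul_sq (b := 2 * b) (by positivity)).mul_const ‖z 0‖)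
      (by simp only [F]; fun_prop) (ae_of_all _ fun v => ?_)
    simp only [F]
    rw [norm_smul, norm_mul, hχn, Complex.norm_real, Real.norm_of_nonneg (Real.exp_pos _).le,
      norm_eq_of_inner_eq h v, mul_one]
  have hFF : ∀ s v, ⟪F s, F (s + v)⟫_ℂ =
      (Real.exp (-(4 * b) * (s + v / 2) ^ 2) : ℂ) * (χ v * ((Real.exp (-b * v ^ 2) : ℂ) * φ v)) := by
    intro s v
    simp only [F]
    rw [inner_smul_left, inner_smul_right, h, add_sub_cancel_left]
    have h1 : conj (χ s) * χ (s + v) = χ v := by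
      simp only [χ]
      rw [← Complex.exp_conj, ← Complex.exp_add]
      congr 1
      simp only [map_mul, Complex.conj_ofReal, Complex.conj_I]
      push_cast
      ring
    have h2 : Real.exp (-(2 * b) * s ^ 2) * Real.exp (-(2 * b) * (s + v) ^ 2) =
        Real.exp (-(4 * b) * (s + v / 2) ^ 2) * Real.exp (-b * v ^ 2) := by
      rw [← Real.exp_add, ← Real.exp_add]; congr 1; ring
    have h2' : (Real.exp (-(2 * b) * s ^ 2) : ℂ) * Real.exp (-(2 * b) * (s + v) ^ 2) =
        Real.exp (-(4 * b) * (s + v / 2) ^ 2) * Real.exp (-b * v ^ 2) := by exact_mod_cast h2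
    rw [map_mul, Complex.conj_ofReal]
    linear_combination (Real.exp (-(2 * b) * s ^ 2) * Real.exp (-(2 * b) * (s + v) ^ 2) * φ v : ℂ) * h1
      + χ v * φ v * h2'
  have hint : Integrable (Function.uncurry fun s v : ℝ => ⟪F s, F (s + v)⟫_ℂ)
      ((volume : Measure ℝ).prod volume) := by
    -- The form `4(s + v/2)² + v²` has smallest eigenvalue `3 - √5 > 2/3`, so a product of Gaussians
    -- with parameter `2b/3` dominates.
    have hb2 : 0 < 2 * b / 3 := by positivity
    refine Integrable.mono' (((integrable_exp_neg_mul_sq hb2).mul_prod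
      (integrable_exp_neg_mul_sq hb2)).mul_const (‖z 0‖ ^ 2)) ?_ (ae_of_all _ fun p => ?_)
    · refine Continuous.aestronglyMeasurable ?_
      simp only [F]
      fun_prop
    · obtain ⟨s, v⟩ := p
      simp only [Function.uncurry, hFF]
      rw [norm_mul, norm_mul, norm_mul, hχn, Complex.norm_real, Complex.norm_real,
        Real.norm_of_nonneg (Real.exp_pos _).le, Real.norm_of_nonneg (Real.exp_pos _).le, one_mul,
        ← mul_assoc, ← Real.exp_add, ← Real.exp_add]
      refine mul_le_mul (Real.exp_le_exp.2 ?_) (hφb v) (norm_nonneg _) (Real.exp_pos _).le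
      nlinarith [sq_nonneg (5 * s + 3 * v), sq_nonneg v, sq_nonneg (s + v / 2), sq_nonneg s,
        mul_nonneg hb.le (sq_nonneg (5 * s + 3 * v)), mul_nonneg hb.le (sq_nonneg v),
        mul_nonneg hb.le (sq_nonneg s)]
  have key : ⟪∫ t, F t, ∫ t, F t⟫_ℂ = (√(Real.pi / (4 * b)) : ℝ) *
      𝓕 (fun v : ℝ => (Real.exp (-b * v ^ 2) : ℂ) * φ v) u := by
    have e1 : ⟪∫ t, F t, ∫ t, F t⟫_ℂ = ∫ s, ∫ t, ⟪F s, F t⟫_ℂ := by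
      simp_rw [integral_inner hF]
      rw [← inner_conj_symm, ← integral_inner hF, ← integral_conj]
      simp_rw [inner_conj_symm]
    have e2 : ∀ s, ∫ t, ⟪F s, F t⟫_ℂ = ∫ v, ⟪F s, F (s + v)⟫_ℂ := fun s =>
      (integral_add_left_eq_self (fun t => ⟪F s, F t⟫_ℂ) s).symm
    simp_rw [e1, e2]
    rw [integral_integral_swap hint]
    simp_rw [hFF]
    have e3 : ∀ v : ℝ, ∫ s : ℝ, (Real.exp (-(4 * b) * (s + v / 2) ^ 2) : ℂ) =
        (√(Real.pi / (4 * b)) : ℝ) := by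
      intro v
      rw [integral_add_right_eq_self (fun s : ℝ => (Real.exp (-(4 * b) * s ^ 2) : ℂ)),
        integral_complex_ofReal, integral_gaussian]
    simp_rw [integral_mul_const, e3, integral_const_mul]
    rw [Real.fourier_eq']
    simp only [χ, smul_eq_mul]
    congr 1
    refine integral_congr_ae (ae_of_all _ fun v => ?_)
    simp [mul_comm u v]
  have hpos : 0 < √(Real.pi / (4 * b)) := Real.sqrt_pos.2 (by positivity)
  have h5 : 0 ≤ ⟪∫ t, F t, ∫ t, F t⟫_ℂ := by
    rw [inner_self_eq_norm_sq_to_K]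
    norm_cast
    positivity
  rw [key] at h5
  rw [Complex.nonneg_iff, Complex.re_ofReal_mul, Complex.im_ofReal_mul] at h5
  exact Complex.nonneg_iff.2 ⟨(mul_nonneg_iff_of_pos_left hpos).1 h5.1,
    ((mul_eq_zero.1 h5.2.symm).resolve_left hpos.ne').symm⟩

/-- Moving the Fourier transform to the Gaussian turns `∫ exp(-w²/c) 𝓕 f(w) dw` into a heat kernel
average of `f`, which tends to `f 0` as `c → ∞`. By nonnegativity these integrals are `L¹` norms,
and Fatou's lemma bounds the norm of `𝓕 f`. -/
theorem integrable_fourier_of_nonneg {f : ℝ → ℂ} (hf : Integrable f) (hc : Continuous f)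
    (h0 : ∀ u, 0 ≤ 𝓕 f u) : Integrable (𝓕 f) := by
  have hcont : Continuous (𝓕 f) :=
    VectorFourier.fourierIntegral_continuous Real.continuous_fourierChar
      (by exact continuous_inner) hf
  have hbdd : ∀ u, ‖𝓕 f u‖ ≤ ∫ v, ‖f v‖ := fun u =>
    VectorFourier.norm_fourierIntegral_le_integral_norm _ _ _ _ _
  have hlim := (Real.tendsto_integral_gaussian_smul' hf (v := 0) hc.continuousAt).comp
    (tendsto_natCast_atTop_atTop.comp (tendsto_add_atTop_nat 1))
  have hB : ∀ c : ℝ, 0 < c → ∫ w : ℝ, ((Real.pi * c : ℂ) ^ (Module.finrank ℝ ℝ / 2 : ℂ) *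
        Complex.exp (-Real.pi ^ 2 * c * ‖0 - w‖ ^ 2)) • f w =
      ∫ w : ℝ, (Real.exp (-c⁻¹ * w ^ 2) : ℂ) * 𝓕 f w := by
    intro c hc
    have J : Integrable (fun w : ℝ ↦ Complex.exp (-(c : ℂ)⁻¹ * ‖w‖ ^ 2 +
        2 * Real.pi * Complex.I * ⟪(0 : ℝ), w⟫_ℝ)) :=
      GaussianFourier.integrable_cexp_neg_mul_sq_norm_add (by simpa) _ _
    have h1 := VectorFourier.integral_fourierIntegral_smul_eq_flip (L := innerₗ ℝ)
      Real.continuous_fourierChar continuous_inner J hf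
    have h2 : ∀ w : ℝ, Complex.exp (-(c : ℂ)⁻¹ * ‖w‖ ^ 2 +
        2 * Real.pi * Complex.I * ⟪(0 : ℝ), w⟫_ℝ) = (Real.exp (-c⁻¹ * w ^ 2) : ℂ) := by
      intro w
      rw [inner_zero_left, Complex.ofReal_exp]
      congr 1
      rw [← Complex.ofReal_pow, Real.norm_eq_abs, sq_abs]
      push_cast
      ring
    have h3 : ∀ w : ℝ, VectorFourier.fourierIntegral Real.fourierChar volume (innerₗ ℝ)
        (fun w : ℝ ↦ Complex.exp (-(c : ℂ)⁻¹ * ‖w‖ ^ 2 +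
          2 * Real.pi * Complex.I * ⟪(0 : ℝ), w⟫_ℝ)) w =
        (Real.pi * c : ℂ) ^ (Module.finrank ℝ ℝ / 2 : ℂ) *
        Complex.exp (-Real.pi ^ 2 * c * ‖0 - w‖ ^ 2) := by
      intro w
      refine (fourier_gaussian_innerProductSpace' (b := (c : ℂ)⁻¹) (by simpa) 0 w).trans ?_
      rw [div_inv_eq_mul, div_inv_eq_mul]
      congr 2
      ring
    have h4 : ∀ w : ℝ, VectorFourier.fourierIntegral Real.fourierChar volume (innerₗ ℝ).flip f w =
        𝓕 f w := by
      intro w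
      rw [flip_innerₗ]
      rfl
    simp_rw [h3, h4, h2] at h1
    exact h1
  let g : ℕ → ℝ → ℂ := fun n w => (Real.exp (-((n + 1 : ℕ) : ℝ)⁻¹ * w ^ 2) : ℂ) * 𝓕 f w
  have hg0 : ∀ n w, 0 ≤ g n w := fun n w =>
    mul_nonneg (by exact_mod_cast (Real.exp_pos _).le) (h0 w)
  have hgi : ∀ n, Integrable (g n) := fun n =>
    integrable_gaussian_mul hcont hbdd (by positivity)
  have hlim' : Tendsto (fun n => ∫ w, g n w) atTop (𝓝 (f 0)) := by
    refine hlim.congr fun n => ?_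
    simp only [Function.comp]
    exact hB _ (by positivity)
  have hnorm : ∀ n, ∫⁻ w, ‖g n w‖ₑ = ‖∫ w, g n w‖ₑ := by
    intro n
    have h1 : ∀ w, g n w = (‖g n w‖ : ℂ) := fun w => Complex.eq_coe_norm_of_nonneg (hg0 n w)
    have h2 : ∫ w, g n w = ((∫ w, ‖g n w‖ : ℝ) : ℂ) := by
      rw [← integral_complex_ofReal]
      exact integral_congr_ae (ae_of_all _ h1)
    rw [h2, ← ofReal_norm, Complex.norm_real,
      Real.norm_of_nonneg (integral_nonneg fun _ => norm_nonneg _),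
      ofReal_integral_norm_eq_lintegral_enorm (hgi n)]
  refine ⟨hcont.aestronglyMeasurable, ?_⟩
  have hfatou := lintegral_liminf_le (μ := (volume : Measure ℝ)) (u := atTop)
    (f := fun n w => ‖g n w‖ₑ) (fun n => by
      have : Continuous (g n) := by simp only [g]; fun_prop
      fun_prop)
  have hpt : ∀ w, Tendsto (fun n => ‖g n w‖ₑ) atTop (𝓝 ‖𝓕 f w‖ₑ) := by
    intro w
    refine (Continuous.tendsto continuous_enorm _).comp ?_
    have h1 : Tendsto (fun n : ℕ => ((n + 1 : ℕ) : ℝ)⁻¹) atTop (𝓝 0) :=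
      tendsto_inv_atTop_zero.comp (tendsto_natCast_atTop_atTop.comp (tendsto_add_atTop_nat 1))
    have h2 : Continuous fun x : ℝ => (Real.exp (-x * w ^ 2) : ℂ) * 𝓕 f w := by fun_prop
    have h3 := (h2.tendsto 0).comp h1
    simp only [neg_zero, zero_mul, Real.exp_zero, Complex.ofReal_one, one_mul] at h3
    exact h3
  have hlim2 : Tendsto (fun n => ‖∫ w, g n w‖ₑ) atTop (𝓝 ‖f 0‖ₑ) :=
    (Continuous.tendsto continuous_enorm _).comp hlim'
  simp_rw [hnorm, fun w => (hpt w).liminf_eq] at hfatou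
  rw [hlim2.liminf_eq] at hfatou
  exact hfatou.trans_lt enorm_lt_top

/-- A continuous integrable function with nonnegative Fourier transform is the characteristic
function of a finite measure. -/
theorem exists_charFun_eq_of_fourier_nonneg {f : ℝ → ℂ} (hf : Integrable f) (hc : Continuous f)
    (h0 : ∀ u, 0 ≤ 𝓕 f u) : ∃ ν : Measure ℝ, IsFiniteMeasure ν ∧ charFun ν = f := by
  have hi := integrable_fourier_of_nonneg hf hc h0
  let ρ : Measure ℝ := volume.withDensity fun u => ‖𝓕 f u‖ₑ
  have hρ : IsFiniteMeasure ρ := isFiniteMeasure_withDensity hi.2.ne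
  -- The dilation passes from the kernel `exp(2πitu)` of Fourier inversion to the kernel `exp(itu)`
  -- of `charFun`.
  refine ⟨ρ.map fun u => 2 * Real.pi * u, by infer_instance, ?_⟩
  have hcont : Continuous (𝓕 f) :=
    VectorFourier.fourierIntegral_continuous Real.continuous_fourierChar
      (by exact continuous_inner) hf
  ext t
  rw [charFun_apply_real, integral_map (by fun_prop) (by fun_prop),
    ← congrFun (hc.fourierInv_fourier_eq hf hi) t, Real.fourierInv_eq']
  have h1 := integral_withDensity_eq_integral_smul (μ := (volume : Measure ℝ))
    (f := fun u => ‖𝓕 f u‖₊) (by fun_prop)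
    (fun u : ℝ => Complex.exp (t * ((2 * Real.pi * u : ℝ) : ℂ) * Complex.I))
  refine h1.trans (integral_congr_ae (ae_of_all _ fun u => ?_))
  simp only
  rw [NNReal.smul_def, coe_nnnorm, smul_eq_mul, Complex.real_smul,
    ← Complex.eq_coe_norm_of_nonneg (h0 u), mul_comm]
  congr 2
  simp
  ring

/-- Lévy's continuity theorem: continuity of the limit at `0` gives tightness, and Prokhorov's
theorem a weak limit along an ultrafilter, whose characteristic function must be `φ`. -/
theorem exists_probabilityMeasure_charFun_eq_of_tendsto {μ : ℕ → ProbabilityMeasure ℝ} {φ : ℝ → ℂ}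
    (hφ : ContinuousAt φ 0) (h : ∀ t, Tendsto (fun n => charFun (μ n) t) atTop (𝓝 (φ t))) :
    ∃ ν : ProbabilityMeasure ℝ, charFun ν = φ := by
  have htight := isTightMeasureSet_of_tendsto_charFun hφ h
  have hcomp : IsCompact (closure (Set.range μ)) := by
    refine isCompact_closure_of_isTightMeasureSet ?_
    convert htight using 1
    ext ν
    simp
  obtain ⟨ν, -, hν⟩ := hcomp.ultrafilter_le_nhds ((Ultrafilter.of atTop).map μ) (by
    refine le_trans ?_ (principal_mono.2 subset_closure)
    simp)
  refine ⟨ν, ?_⟩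
  ext t
  have hν' : Tendsto μ ((Ultrafilter.of atTop : Ultrafilter ℕ) : Filter ℕ) (𝓝 ν) := hν
  rw [ProbabilityMeasure.tendsto_iff_forall_integral_rclike_tendsto ℂ] at hν'
  have h1 := hν' (BoundedContinuousFunction.innerProbChar t)
  simp_rw [← charFun_eq_integral_innerProbChar] at h1
  exact tendsto_nhds_unique h1 ((h t).mono_left (Ultrafilter.of_le atTop))

theorem exists_charFun_eq_of_tendsto {μ : ℕ → Measure ℝ} [∀ n, IsFiniteMeasure (μ n)] {φ : ℝ → ℂ}
    (hφ : ContinuousAt φ 0) (h : ∀ t, Tendsto (fun n => charFun (μ n) t) atTop (𝓝 (φ t)))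
    (hμ : ∀ n, charFun (μ n) 0 = 1) :
    ∃ ν : Measure ℝ, IsFiniteMeasure ν ∧ charFun ν = φ := by
  have hp : ∀ n, IsProbabilityMeasure (μ n) := fun n => by
    have := hμ n
    rw [charFun_zero] at this
    have h2 : (μ n).real Set.univ = 1 := by exact_mod_cast this
    exact ⟨by rwa [measureReal_def, ENNReal.toReal_eq_one_iff] at h2⟩
  obtain ⟨ν, hν⟩ := exists_probabilityMeasure_charFun_eq_of_tendsto
    (μ := fun n => ⟨μ n, hp n⟩) hφ h
  exact ⟨ν, inferInstance, hν⟩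

/-- **Bochner's theorem** for covariances of continuous stationary curves in a Hilbert space. -/
theorem exists_charFun_eq_of_inner_eq [CompleteSpace H] {z : ℝ → H} {φ : ℝ → ℂ} (hz : Continuous z)
    (h : ∀ s t, ⟪z s, z t⟫_ℂ = φ (t - s)) :
    ∃ ν : Measure ℝ, IsFiniteMeasure ν ∧ charFun ν = φ := by
  have hφ := continuous_of_inner_eq hz h
  have hφb := norm_le_of_inner_eq h
  by_cases hz0 : z 0 = 0
  · refine ⟨0, inferInstance, ?_⟩
    ext t
    have := hφb t
    rw [hz0, norm_zero] at this
    simp only [ne_eq, OfNat.ofNat_ne_zero, not_false_eq_true, zero_pow, norm_le_zero_iff] at this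
    simp [this]
  -- Normalizing makes the approximating measures probability measures.
  wlog hone : ‖z 0‖ = 1 generalizing z φ
  · have hn : (‖z 0‖ : ℂ) ≠ 0 := by exact_mod_cast norm_ne_zero_iff.2 hz0
    have h' : ∀ s t, ⟪(‖z 0‖ : ℂ)⁻¹ • z s, (‖z 0‖ : ℂ)⁻¹ • z t⟫_ℂ =
        ((‖z 0‖ : ℂ) ^ 2)⁻¹ * φ (t - s) := by
      intro s t
      rw [inner_smul_left, inner_smul_right, h, map_inv₀, Complex.conj_ofReal]
      ring
    obtain ⟨ν, hν, hνφ⟩ := this (z := fun t => (‖z 0‖ : ℂ)⁻¹ • z t)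
      (φ := fun t => ((‖z 0‖ : ℂ) ^ 2)⁻¹ * φ t) (by fun_prop) h' (by fun_prop)
      (norm_le_of_inner_eq (z := fun t => (‖z 0‖ : ℂ)⁻¹ • z t)
        (φ := fun t => ((‖z 0‖ : ℂ) ^ 2)⁻¹ * φ t) h') (by simp [hz0]) (by
        rw [norm_smul, norm_inv, Complex.norm_real, norm_norm]
        exact inv_mul_cancel₀ (norm_ne_zero_iff.2 hz0))
    refine ⟨(‖z 0‖₊ ^ 2) • ν, inferInstance, ?_⟩
    ext t
    rw [charFun_apply_real, integral_smul_nnreal_measure, ← charFun_apply_real, hνφ, NNReal.smul_def,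
      Complex.real_smul]
    push_cast
    field_simp
  have hφ0 : φ 0 = 1 := by
    have := h 0 0
    rw [inner_self_eq_norm_sq_to_K, hone] at this
    simpa using this.symm
  have hb : ∀ n : ℕ, (0 : ℝ) < ((n + 1 : ℕ) : ℝ)⁻¹ := fun n => by positivity
  choose ν hν hνφ using fun n : ℕ => exists_charFun_eq_of_fourier_nonneg
    (integrable_gaussian_mul hφ hφb (hb n)) (by fun_prop)
    (fun u => fourier_gaussian_mul_nonneg hz h (hb n) u)
  refine exists_charFun_eq_of_tendsto (μ := ν) hφ.continuousAt (fun t => ?_) fun n => ?_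
  · have h1 : Tendsto (fun n : ℕ => ((n + 1 : ℕ) : ℝ)⁻¹) atTop (𝓝 0) :=
      tendsto_inv_atTop_zero.comp (tendsto_natCast_atTop_atTop.comp (tendsto_add_atTop_nat 1))
    have h2 : Continuous fun x : ℝ => (Real.exp (-x * t ^ 2) : ℂ) * φ t := by fun_prop
    have h3 := (h2.tendsto 0).comp h1
    simp only [neg_zero, zero_mul, Real.exp_zero, Complex.ofReal_one, one_mul] at h3
    refine h3.congr fun n => ?_
    rw [hνφ]
    rfl
  · rw [hνφ]
    simp [hφ0]

end Bochner

namespace LevyKhintchine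

/-! ### Identities and bounds for `e` and `rIntegrand`. -/

theorem e_zero (u : ℝ) : e 0 u = 0 := by
  simp [e]

theorem e_mul_self (t u : ℝ) :
    e t u * (Complex.I * u) = Complex.exp (Complex.I * t * u) - 1 := by
  by_cases hu : u = 0
  · simp [hu]
  · have hc : Complex.I * (u : ℂ) ≠ 0 :=
      mul_ne_zero Complex.I_ne_zero (Complex.ofReal_ne_zero.mpr hu)
    simp [e, hu, hc]

theorem e_add (g t u : ℝ) : e (g + t) u = e g u + Complex.exp (Complex.I * g * u) * e t u := by
  by_cases hu : u = 0
  · simp [e, hu]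
  · have hc : Complex.I * (u : ℂ) ≠ 0 :=
      mul_ne_zero Complex.I_ne_zero (Complex.ofReal_ne_zero.mpr hu)
    refine mul_right_cancel₀ hc ?_
    rw [add_mul, mul_assoc, e_mul_self, e_mul_self, e_mul_self, mul_sub, ← Complex.exp_add]
    push_cast
    ring_nf

theorem norm_exp_I_mul (t u : ℝ) : ‖Complex.exp (Complex.I * t * u)‖ = 1 := by
  rw [mul_assoc, mul_comm, ← Complex.ofReal_mul]
  exact Complex.norm_exp_ofReal_mul_I _

theorem conj_exp_I_mul (t u : ℝ) :
    conj (Complex.exp (Complex.I * t * u)) = Complex.exp (-(Complex.I * t * u)) := by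
  rw [← Complex.exp_conj]
  simp

theorem conj_exp_I_mul_self (t u : ℝ) :
    conj (Complex.exp (Complex.I * t * u)) * Complex.exp (Complex.I * t * u) = 1 := by
  rw [conj_exp_I_mul, ← Complex.exp_add, neg_add_cancel, Complex.exp_zero]

theorem measurable_e (t : ℝ) : Measurable (e t) := by
  refine Measurable.ite (measurableSet_singleton 0) measurable_const ?_
  fun_prop

theorem continuous_e_left (u : ℝ) : Continuous fun t => e t u := by
  by_cases hu : u = 0
  · simp only [e, hu, if_true]; fun_prop
  · simp only [e, hu, if_false]; fun_prop

theorem norm_e_le (t u : ℝ) : ‖e t u‖ ≤ |t| := by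
  rw [e_eq_integral]
  have h := intervalIntegral.norm_integral_le_of_norm_le_const (a := (0 : ℝ)) (b := t) (C := 1)
    (f := fun τ : ℝ => Complex.exp (Complex.I * τ * u)) fun τ _ => (norm_exp_I_mul τ u).le
  simpa using h

theorem norm_e_mul_abs_le (t u : ℝ) : ‖e t u‖ * |u| ≤ 2 := by
  have h1 : ‖e t u * (Complex.I * u)‖ = ‖e t u‖ * |u| := by simp
  rw [← h1, e_mul_self]
  refine (norm_sub_le _ _).trans ?_
  rw [norm_exp_I_mul, norm_one]
  norm_num

theorem norm_e_sq_le (t u : ℝ) : ‖e t u‖ ^ 2 ≤ (t ^ 2 + 4) * (1 / (1 + u ^ 2)) := by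
  rw [mul_one_div, le_div_iff₀ (by positivity)]
  have h1 : ‖e t u‖ ^ 2 ≤ t ^ 2 := by
    rw [← sq_abs t]
    exact pow_le_pow_left₀ (norm_nonneg _) (norm_e_le t u) 2
  have h2 : (‖e t u‖ * |u|) ^ 2 ≤ 2 ^ 2 :=
    pow_le_pow_left₀ (by positivity) (norm_e_mul_abs_le t u) 2
  rw [mul_pow, sq_abs] at h2
  linarith

theorem FiniteCondition.integrable {σ : Measure ℝ} (h : FiniteCondition σ) :
    Integrable (fun u : ℝ => 1 / (1 + u ^ 2)) σ := by
  have hc : Continuous fun u : ℝ => 1 / (1 + u ^ 2) :=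
    continuous_const.div (by fun_prop) fun u => by positivity
  refine ⟨hc.aestronglyMeasurable, ?_⟩
  rw [hasFiniteIntegral_iff_ofReal (ae_of_all _ fun u => by positivity)]
  exact h

theorem FiniteCondition.memLp_e {σ : Measure ℝ} (h : FiniteCondition σ) (t : ℝ) :
    MemLp (e t) 2 σ := by
  rw [memLp_two_iff_integrable_sq_norm (measurable_e t).aestronglyMeasurable]
  refine Integrable.mono' (h.integrable.const_mul (t ^ 2 + 4))
    ((measurable_e t).norm.pow_const 2).aestronglyMeasurable (ae_of_all _ fun u => ?_)
  rw [Real.norm_of_nonneg (by positivity)]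
  exact norm_e_sq_le t u

theorem integrable_conj_mul {α : Type*} [MeasurableSpace α] {σ : Measure α} {f g : α → ℂ}
    (hf : MemLp f 2 σ) (hg : MemLp g 2 σ) : Integrable (fun u => conj (f u) * g u) σ := by
  have hf' : MemLp (fun u => conj (f u)) 2 σ := hf.star
  exact hf'.integrable_mul hg

theorem FiniteCondition.integrable_e {σ : Measure ℝ} (h : FiniteCondition σ) (s t : ℝ) :
    Integrable (fun u => conj (e s u) * e t u) σ :=
  integrable_conj_mul (h.memLp_e s) (h.memLp_e t)

theorem norm_exp_I_mul_sub_le (x : ℝ) : ‖Complex.exp (Complex.I * x) - 1 - Complex.I * x‖ ≤ 3 * x ^ 2 := by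
  have hx : ‖Complex.I * (x : ℂ)‖ = |x| := by simp
  by_cases h : |x| ≤ 1
  · have := Complex.norm_exp_sub_one_sub_id_le (x := Complex.I * x) (by rwa [hx])
    rw [hx, sq_abs] at this
    nlinarith [sq_nonneg x]
  · have h1 : ‖Complex.exp (Complex.I * x)‖ = 1 := by
      rw [mul_comm]; exact Complex.norm_exp_ofReal_mul_I x
    have h2 := norm_sub_le (Complex.exp (Complex.I * x) - 1) (Complex.I * x)
    have h3 := norm_sub_le (Complex.exp (Complex.I * x)) 1
    rw [h1, norm_one] at h3
    rw [hx] at h2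
    rw [← sq_abs]
    nlinarith

theorem norm_rIntegrand_le (t u : ℝ) :
    ‖rIntegrand t u‖ ≤ (6 * t ^ 2 + 2 * |t| + 4) * (1 / (1 + u ^ 2)) := by
  rw [mul_one_div, le_div_iff₀ (by positivity)]
  have ht := abs_nonneg t
  by_cases hu : u = 0
  · simp [rIntegrand, hu]
    nlinarith [sq_nonneg t]
  have hu2 : 0 < u ^ 2 := by positivity
  have hq : 0 < 1 + u ^ 2 := by positivity
  have hqc : (1 + (u : ℂ) ^ 2) ≠ 0 := by exact_mod_cast hq.ne'
  simp only [rIntegrand, hu, if_false]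
  rw [norm_div, norm_pow, Complex.norm_real, Real.norm_eq_abs, sq_abs, div_mul_eq_mul_div,
    div_le_iff₀ hu2]
  have hau : |u| ≤ 1 + u ^ 2 := by rw [← sq_abs]; nlinarith [sq_nonneg (|u| - 1)]
  have hau0 := abs_nonneg u
  have hterm : ‖Complex.I * t * u / (1 + (u : ℂ) ^ 2)‖ = |t| * |u| / (1 + u ^ 2) := by
    rw [norm_div]
    have : ‖1 + (u : ℂ) ^ 2‖ = 1 + u ^ 2 := by
      rw [← Complex.ofReal_one, ← Complex.ofReal_pow, ← Complex.ofReal_add, Complex.norm_real,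
        Real.norm_of_nonneg hq.le]
    rw [this]; simp
  have hterm2 : |t| * |u| / (1 + u ^ 2) ≤ |t| := by
    rw [div_le_iff₀ hq]; exact mul_le_mul_of_nonneg_left hau ht
  by_cases h1 : u ^ 2 ≤ 1
  -- Since `1/(1 + u²) = 1 - u²/(1 + u²)`, the compensator cancels the linear Taylor term and leaves
  -- terms of order `u²`.
  · have hsplit : 1 - Complex.exp (Complex.I * t * u) + Complex.I * t * u / (1 + (u : ℂ) ^ 2) =
        -(Complex.exp (Complex.I * (t * u : ℝ)) - 1 - Complex.I * (t * u : ℝ)) -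
          Complex.I * t * u / (1 + (u : ℂ) ^ 2) * (u : ℂ) ^ 2 := by
      push_cast
      field_simp
      ring
    rw [hsplit]
    have h2 := norm_sub_le (-(Complex.exp (Complex.I * (t * u : ℝ)) - 1 - Complex.I * (t * u : ℝ)))
      (Complex.I * t * u / (1 + (u : ℂ) ^ 2) * (u : ℂ) ^ 2)
    rw [norm_neg, norm_mul, hterm, norm_pow, Complex.norm_real, Real.norm_eq_abs, sq_abs] at h2
    have h3 := norm_exp_I_mul_sub_le (t * u)
    have h4 := mul_le_mul_of_nonneg_right hterm2 hu2.le
    have h5 := h2.trans (add_le_add h3 h4)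
    calc _ ≤ (3 * (t * u) ^ 2 + |t| * u ^ 2) * (1 + u ^ 2) :=
          mul_le_mul_of_nonneg_right h5 hq.le
      _ ≤ (3 * (t * u) ^ 2 + |t| * u ^ 2) * 2 :=
          mul_le_mul_of_nonneg_left (by linarith) (by positivity)
      _ ≤ _ := by nlinarith
  · have h2 := norm_add_le (1 - Complex.exp (Complex.I * t * u))
      (Complex.I * t * u / (1 + (u : ℂ) ^ 2))
    have h3 := norm_sub_le 1 (Complex.exp (Complex.I * t * u))
    rw [norm_exp_I_mul, norm_one] at h3
    rw [hterm] at h2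
    have h5 : ‖1 - Complex.exp (Complex.I * t * u) + Complex.I * t * u / (1 + (u : ℂ) ^ 2)‖ ≤
        2 + |t| := by linarith
    calc _ ≤ (2 + |t|) * (1 + u ^ 2) := mul_le_mul_of_nonneg_right h5 hq.le
      _ ≤ (2 + |t|) * (2 * u ^ 2) := mul_le_mul_of_nonneg_left (by linarith) (by positivity)
      _ ≤ _ := by nlinarith [mul_nonneg (sq_nonneg t) (sq_nonneg u)]

theorem measurable_rIntegrand (t : ℝ) : Measurable (rIntegrand t) := by
  refine Measurable.ite (measurableSet_singleton 0) measurable_const ?_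
  fun_prop

theorem continuous_rIntegrand_left (u : ℝ) : Continuous fun t => rIntegrand t u := by
  by_cases hu : u = 0
  · simp only [rIntegrand, hu, if_true]; fun_prop
  · simp only [rIntegrand, hu, if_false]; fun_prop

theorem rIntegrand_neg (t u : ℝ) : rIntegrand (-t) u = conj (rIntegrand t u) := by
  by_cases hu : u = 0
  · simp [rIntegrand, hu, map_ofNat]
  · simp only [rIntegrand, hu, if_false]
    simp only [map_div₀, map_add, map_sub, map_one, map_mul, map_pow, Complex.conj_ofReal,
      Complex.conj_I, conj_exp_I_mul]
    push_cast
    ring_nf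

theorem rIntegrand_relation (s t u : ℝ) :
    rIntegrand t u + conj (rIntegrand s u) - rIntegrand (t - s) u = conj (e s u) * e t u := by
  by_cases hu : u = 0
  · simp [rIntegrand, e, hu, map_ofNat]; ring
  · have huc : (u : ℂ) ≠ 0 := Complex.ofReal_ne_zero.mpr hu
    have h1 : Complex.exp (Complex.I * (t - s : ℝ) * u) =
        Complex.exp (-(Complex.I * s * u)) * Complex.exp (Complex.I * t * u) := by
      rw [← Complex.exp_add]; push_cast; ring_nf
    simp only [rIntegrand, e, hu, if_false, h1]
    simp only [map_div₀, map_add, map_sub, map_one, map_mul, map_pow, Complex.conj_ofReal,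
      Complex.conj_I, conj_exp_I_mul]
    have hden : -Complex.I * (u : ℂ) * (Complex.I * u) = (u : ℂ) ^ 2 := by
      linear_combination -(u : ℂ) ^ 2 * Complex.I_sq
    rw [div_mul_div_comm, hden, ← add_div, ← sub_div]
    congr 1
    push_cast
    ring

/-! ### The function `r` and its uniqueness up to a linear term. -/

variable {σ : Measure ℝ}

theorem FiniteCondition.integrable_rIntegrand (h : FiniteCondition σ) (t : ℝ) :
    Integrable (rIntegrand t) σ :=
  Integrable.mono' (h.integrable.const_mul _) (measurable_rIntegrand t).aestronglyMeasurable
    (ae_of_all _ (norm_rIntegrand_le t))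

theorem abs_le_of_mem_ball {s t : ℝ} (h : s ∈ Metric.ball t 1) : |s| ≤ |t| + 1 := by
  rw [Metric.mem_ball, Real.dist_eq] at h
  have := abs_sub_abs_le_abs_sub s t
  linarith

theorem FiniteCondition.continuous_r (h : FiniteCondition σ) : Continuous (r σ) := by
  refine continuous_iff_continuousAt.2 fun t => ?_
  refine continuousAt_of_dominated
    (bound := fun u => (6 * (|t| + 1) ^ 2 + 2 * (|t| + 1) + 4) * (1 / (1 + u ^ 2)))
    (Eventually.of_forall fun s => (measurable_rIntegrand s).aestronglyMeasurable) ?_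
    (h.integrable.const_mul _) (ae_of_all _ fun u => (continuous_rIntegrand_left u).continuousAt)
  filter_upwards [Metric.ball_mem_nhds t one_pos] with s hs
  refine ae_of_all _ fun u => (norm_rIntegrand_le s u).trans ?_
  have h1 := abs_le_of_mem_ball hs
  have h2 : s ^ 2 ≤ (|t| + 1) ^ 2 := by
    rw [← sq_abs s]; exact pow_le_pow_left₀ (abs_nonneg s) h1 2
  exact mul_le_mul_of_nonneg_right (by linarith) (by positivity)

theorem FiniteCondition.continuous_integral_norm_e_sq (h : FiniteCondition σ) :
    Continuous fun t => ∫ u, ‖e t u‖ ^ 2 ∂σ := by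
  refine continuous_iff_continuousAt.2 fun t => ?_
  refine continuousAt_of_dominated
    (bound := fun u => ((|t| + 1) ^ 2 + 4) * (1 / (1 + u ^ 2)))
    (Eventually.of_forall fun s => ((measurable_e s).norm.pow_const 2).aestronglyMeasurable) ?_
    (h.integrable.const_mul _)
    (ae_of_all _ fun u => ((continuous_e_left u).norm.pow 2).continuousAt)
  filter_upwards [Metric.ball_mem_nhds t one_pos] with s hs
  refine ae_of_all _ fun u => ?_
  rw [Real.norm_of_nonneg (by positivity)]
  refine (norm_e_sq_le s u).trans ?_
  have h1 := abs_le_of_mem_ball hs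
  have h2 : s ^ 2 ≤ (|t| + 1) ^ 2 := by
    rw [← sq_abs s]; exact pow_le_pow_left₀ (abs_nonneg s) h1 2
  exact mul_le_mul_of_nonneg_right (by linarith) (by positivity)

theorem r_neg (t : ℝ) : r σ (-t) = conj (r σ t) := by
  simp only [r, rIntegrand_neg]
  exact integral_conj

theorem FiniteCondition.satisfiesRelation_r (h : FiniteCondition σ) :
    SatisfiesRelation σ (r σ) := by
  intro s t
  have hs : Integrable (fun u => conj (rIntegrand s u)) σ := by
    simp_rw [← rIntegrand_neg]; exact h.integrable_rIntegrand _
  have ht := h.integrable_rIntegrand t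
  have hts : Integrable (fun u => rIntegrand t u + conj (rIntegrand s u)) σ := ht.add hs
  simp only [r, kernelOf]
  rw [← integral_conj, ← integral_add ht hs, ← integral_sub hts (h.integrable_rIntegrand _)]
  exact integral_congr_ae (ae_of_all _ fun u => rIntegrand_relation s t u)

/-- By the relation, `r(x_j - x_k)` is a function of `j` plus a function of `k` minus `C_σ(x_k,
x_j)`. The first two vanish when `∑ c_j = 0`; the last contributes `-∫ |∑ c_j e_{x_j}|² dσ`. -/
theorem FiniteCondition.isNegDefFun_r (h : FiniteCondition σ) : IsNegDefFun (r σ) := by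
  refine ⟨fun x y => by rw [← r_neg, neg_sub], fun n x c hc => ?_⟩
  have hrel := h.satisfiesRelation_r
  have h1 : ∑ j, ∑ k, c j * conj (c k) * r σ (x j - x k) =
      -∑ j, ∑ k, c j * conj (c k) * kernelOf σ (x k) (x j) := by
    have h2 : ∀ j k, c j * conj (c k) * r σ (x j - x k) =
        (c j * r σ (x j)) * conj (c k) + c j * (conj (c k * r σ (x k))) -
          c j * conj (c k) * kernelOf σ (x k) (x j) := by
      intro j k
      rw [← hrel, map_mul]; ring
    have hc' : ∑ k, conj (c k) = 0 := by rw [← map_sum, hc, map_zero]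
    simp_rw [h2, Finset.sum_sub_distrib, Finset.sum_add_distrib, ← Finset.mul_sum, hc',
      ← Finset.sum_mul, hc]
    simp
  have h3 : ∑ j, ∑ k, c j * conj (c k) * kernelOf σ (x k) (x j) =
      ((∫ u, ‖∑ j, c j * e (x j) u‖ ^ 2 ∂σ : ℝ) : ℂ) := by
    have h4 : ∀ u, ((‖∑ j, c j * e (x j) u‖ ^ 2 : ℝ) : ℂ) =
        ∑ j, ∑ k, c j * conj (c k) * (conj (e (x k) u) * e (x j) u) := by
      intro u
      rw [Complex.ofReal_pow, ← Complex.mul_conj', map_sum, Finset.sum_mul_sum]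
      refine Finset.sum_congr rfl fun j _ => Finset.sum_congr rfl fun k _ => ?_
      rw [map_mul]; ring
    rw [← integral_complex_ofReal]
    simp_rw [h4]
    rw [integral_finsetSum]
    · refine Finset.sum_congr rfl fun j _ => ?_
      rw [integral_finsetSum]
      · refine Finset.sum_congr rfl fun k _ => ?_
        rw [integral_const_mul]; rfl
      · exact fun k _ => (h.integrable_e _ _).const_mul _
    · exact fun j _ => integrable_finsetSum _ fun k _ => (h.integrable_e _ _).const_mul _
  rw [h1, h3, neg_nonpos]
  exact_mod_cast integral_nonneg fun u => by positivity

/-- The difference `d` satisfies `d(t) + conj d(s) = d(t - s)`. Taking `s = t` shows that `d` is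
imaginary, hence additive, and continuity makes it real linear. -/
theorem SatisfiesRelation.exists_eq_add {ρ₁ ρ₂ : ℝ → ℂ} (h₁ : SatisfiesRelation σ ρ₁)
    (h₂ : SatisfiesRelation σ ρ₂) (hc₁ : Continuous ρ₁) (hc₂ : Continuous ρ₂) :
    ∃ μ : ℝ, ∀ t : ℝ, ρ₂ t = ρ₁ t + Complex.I * t * μ := by
  have hd : ∀ s t, (ρ₂ t - ρ₁ t) + conj (ρ₂ s - ρ₁ s) = ρ₂ (t - s) - ρ₁ (t - s) := by
    intro s t
    rw [map_sub]
    linear_combination h₂ s t - h₁ s t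
  obtain ⟨d, hdd⟩ : ∃ d : ℝ → ℂ, d = fun t => ρ₂ t - ρ₁ t := ⟨_, rfl⟩
  have hd' : ∀ s t, d t + conj (d s) = d (t - s) := fun s t => by simp only [hdd]; exact hd s t
  have hdc : Continuous d := by rw [hdd]; fun_prop
  have h0 : d 0 = 0 := by
    have := hd' 0 0
    rw [sub_zero, add_eq_left] at this
    simpa using this
  have hc : ∀ t, conj (d t) = -d t := fun t => by
    have := hd' t t
    rw [sub_self, h0] at this
    linear_combination this
  have hadd : ∀ s t, d (s + t) = d s + d t := fun s t => by
    have := hd' t (s + t)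
    rw [hc, add_sub_cancel_right] at this
    linear_combination this
  let D : ℝ →+ ℂ := ⟨⟨d, h0⟩, hadd⟩
  have hlin : ∀ t : ℝ, d t = t * d 1 := fun t => by
    have := (D.toRealLinearMap hdc).map_smul t 1
    rwa [smul_eq_mul, mul_one, Complex.real_smul] at this
  have hre : (d 1).re = 0 := by
    have := congrArg Complex.re (hc 1)
    simp only [Complex.conj_re, Complex.neg_re] at this
    linarith
  refine ⟨(d 1).im, fun t => ?_⟩
  have h1 : d 1 = (d 1).im * Complex.I := by
    apply Complex.ext <;> simp [hre]
  have h2 : d t = ρ₂ t - ρ₁ t := by rw [hdd]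
  have h3 := hlin t
  rw [h1] at h3
  linear_combination h3 - h2

/-! ### Curves with stationary increments and their spectral measure. -/

section StationaryIncrements

variable {H : Type*} [NormedAddCommGroup H] [InnerProductSpace ℂ H]

/-- A curve in a Hilbert space whose increments have translation invariant inner products. -/
def HasStationaryIncrements (x : ℝ → H) : Prop :=
  ∀ g p q p' q' : ℝ,
    ⟪x (g + p) - x (g + q), x (g + p') - x (g + q')⟫_ℂ = ⟪x p - x q, x p' - x q'⟫_ℂ

theorem HasStationaryIncrements.norm_sub {x : ℝ → H} (h : HasStationaryIncrements x) (h0 : x 0 = 0)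
    (s t : ℝ) : ‖x (s + t) - x s‖ = ‖x t‖ := by
  have h1 := h s t 0 t 0
  rw [add_zero, h0, sub_zero, inner_self_eq_norm_sq_to_K, inner_self_eq_norm_sq_to_K] at h1
  have h4 : ‖x (s + t) - x s‖ ^ 2 = ‖x t‖ ^ 2 := by exact_mod_cast h1
  exact (sq_eq_sq₀ (norm_nonneg _) (norm_nonneg _)).1 h4

/-- Cutting the way from `0` to `t` into equal steps of length at most `1` bounds `‖x t‖` by a sum
of equally many norms on `[-1, 1]`. This linear growth makes the integral in `stationaryPart`
converge. -/
theorem HasStationaryIncrements.exists_norm_le {x : ℝ → H} (h : HasStationaryIncrements x)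
    (h0 : x 0 = 0) (hx : Continuous x) : ∃ M : ℝ, 0 ≤ M ∧ ∀ t, ‖x t‖ ≤ (|t| + 1) * M := by
  obtain ⟨M, hM⟩ := (isCompact_Icc (a := (-1 : ℝ)) (b := 1)).exists_bound_of_continuousOn
    hx.continuousOn
  have hM0 : 0 ≤ M := (norm_nonneg _).trans (hM 0 (by constructor <;> norm_num))
  have hn : ∀ n : ℕ, ∀ t : ℝ, |t| ≤ n → ‖x t‖ ≤ n * M := by
    intro n
    induction n with
    | zero =>
      intro t ht
      have : t = 0 := by simpa using ht
      simp [this, h0]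
    | succ n ih =>
      intro t ht
      have hp : (0 : ℝ) < n + 1 := by positivity
      push_cast at ht ⊢
      have hd : |t / (n + 1)| ≤ 1 := by
        rw [abs_div, abs_of_pos hp, div_le_one hp]; exact ht
      have h1 : ‖x (t / (n + 1) * n)‖ ≤ n * M := by
        refine ih _ ?_
        rw [abs_mul, Nat.abs_cast]
        exact mul_le_of_le_one_left (Nat.cast_nonneg n) hd
      have h2 := h.norm_sub h0 (t / (n + 1) * n) (t / (n + 1))
      have h3 := hM _ (abs_le.1 hd)
      have h4 : t / (n + 1) * n + t / (n + 1) = t := by field_simp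
      rw [h4] at h2
      have h5 := norm_sub_norm_le (x t) (x (t / (n + 1) * n))
      linarith
  refine ⟨M, hM0, fun t => (hn ⌈|t|⌉₊ t (Nat.le_ceil _)).trans ?_⟩
  exact mul_le_mul_of_nonneg_right (Nat.ceil_lt_add_one (abs_nonneg t)).le hM0

/-- The stationary curve `z_t = ∫₀^∞ exp(-a) (x_t - x_{t-a}) da`. -/
noncomputable def stationaryPart (x : ℝ → H) (t : ℝ) : H :=
  ∫ a in Set.Ioi (0 : ℝ), Real.exp (-a) • (x t - x (t - a))

theorem integrableOn_exp_mul_linear (M : ℝ) :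
    IntegrableOn (fun a : ℝ => Real.exp (-a) * ((|a| + 1) * M)) (Set.Ioi 0) := by
  have h1 : IntegrableOn (fun a : ℝ => Real.exp (-a)) (Set.Ioi 0) := integrableOn_exp_neg_Ioi 0
  have h2 : IntegrableOn (fun a : ℝ => Real.exp (-a) * a) (Set.Ioi 0) := by
    refine (Real.GammaIntegral_convergent (s := 2) two_pos).congr_fun (fun a _ => ?_)
      measurableSet_Ioi
    norm_num
  refine IntegrableOn.congr_fun (Integrable.mul_const (h2.add h1) M) (fun a ha => ?_)
    measurableSet_Ioi
  simp only [Pi.add_apply, abs_of_pos (show 0 < a from ha)]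
  ring

variable {x : ℝ → H}

theorem HasStationaryIncrements.norm_exp_smul_le (h : HasStationaryIncrements x) (h0 : x 0 = 0)
    {M : ℝ} (hM : ∀ t, ‖x t‖ ≤ (|t| + 1) * M) (t a : ℝ) :
    ‖Real.exp (-a) • (x t - x (t - a))‖ ≤ Real.exp (-a) * ((|a| + 1) * M) := by
  rw [norm_smul, Real.norm_of_nonneg (Real.exp_pos _).le]
  refine mul_le_mul_of_nonneg_left ?_ (Real.exp_pos _).le
  have := h.norm_sub h0 (t - a) a
  rw [sub_add_cancel] at this
  rw [this]
  exact hM a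

theorem HasStationaryIncrements.integrableOn (h : HasStationaryIncrements x) (h0 : x 0 = 0)
    (hx : Continuous x) (t : ℝ) :
    IntegrableOn (fun a => Real.exp (-a) • (x t - x (t - a))) (Set.Ioi 0) := by
  obtain ⟨M, -, hM⟩ := h.exists_norm_le h0 hx
  exact Integrable.mono' (integrableOn_exp_mul_linear M)
    (Continuous.aestronglyMeasurable (by fun_prop)) (ae_of_all _ (h.norm_exp_smul_le h0 hM t))

theorem HasStationaryIncrements.continuous_stationaryPart (h : HasStationaryIncrements x)
    (h0 : x 0 = 0) (hx : Continuous x) : Continuous (stationaryPart x) := by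
  obtain ⟨M, -, hM⟩ := h.exists_norm_le h0 hx
  exact continuous_of_dominated
    (fun t => Continuous.aestronglyMeasurable (by fun_prop))
    (fun t => ae_of_all _ (h.norm_exp_smul_le h0 hM t)) (integrableOn_exp_mul_linear M)
    (ae_of_all _ fun a => by fun_prop)

variable [CompleteSpace H]

theorem inner_integral_integral {α : Type*} [MeasurableSpace α] {μ : Measure α} {f g : α → H}
    (hf : Integrable f μ) (hg : Integrable g μ) :
    ⟪∫ a, f a ∂μ, ∫ a, g a ∂μ⟫_ℂ = ∫ a, ∫ b, ⟪f a, g b⟫_ℂ ∂μ ∂μ := by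
  simp_rw [integral_inner hg]
  rw [← inner_conj_symm, ← integral_inner hf, ← integral_conj]
  simp_rw [inner_conj_symm]

theorem HasStationaryIncrements.inner_stationaryPart (h : HasStationaryIncrements x)
    (h0 : x 0 = 0) (hx : Continuous x) (s t : ℝ) :
    ⟪stationaryPart x s, stationaryPart x t⟫_ℂ =
      ⟪stationaryPart x 0, stationaryPart x (t - s)⟫_ℂ := by
  simp only [stationaryPart]
  rw [inner_integral_integral (h.integrableOn h0 hx s) (h.integrableOn h0 hx t),
    inner_integral_integral (h.integrableOn h0 hx 0) (h.integrableOn h0 hx (t - s))]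
  refine integral_congr_ae (ae_of_all _ fun a => integral_congr_ae (ae_of_all _ fun b => ?_))
  simp only [← Complex.coe_smul, inner_smul_left, inner_smul_right]
  have := h s 0 (0 - a) (t - s) (t - s - b)
  rw [add_zero, show s + (0 - a) = s - a by ring, show s + (t - s) = t by ring,
    show s + (t - s - b) = t - b by ring] at this
  rw [this]

/-- With `z` the stationary part, `y = x - z` is `y_t = exp(-t) ∫_{-∞}^t exp(b) x_b db`, so `y' = x
- y = z`. Integrate from `0`, where `y_0 = -z_0`. -/
theorem HasStationaryIncrements.eq_stationaryPart_add_integral (h : HasStationaryIncrements x)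
    (h0 : x 0 = 0) (hx : Continuous x) (t : ℝ) :
    x t = stationaryPart x t - stationaryPart x 0 + ∫ τ in (0 : ℝ)..t, stationaryPart x τ := by
  let F : ℝ → H := fun b => Real.exp b • x b
  have hFc : Continuous F := by simp only [F]; fun_prop
  have hint1 : ∀ t, IntegrableOn (fun a => Real.exp (-a) • x (t - a)) (Set.Ioi 0) := by
    intro t
    have h1 : IntegrableOn (fun a : ℝ => Real.exp (-a) • x t) (Set.Ioi 0) :=
      (integrableOn_exp_neg_Ioi 0).smul_const _
    refine (h1.sub (h.integrableOn h0 hx t)).congr_fun (fun a _ => ?_) measurableSet_Ioi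
    simp only [Pi.sub_apply, smul_sub, sub_sub_cancel]
  have hy1 : ∀ t, x t - stationaryPart x t = ∫ a in Set.Ioi (0 : ℝ), Real.exp (-a) • x (t - a) := by
    intro t
    have h2 : ∫ a in Set.Ioi (0 : ℝ), Real.exp (-a) • x t = x t := by
      rw [integral_smul_const, integral_exp_neg_Ioi_zero, one_smul]
    nth_rewrite 1 [← h2]
    simp only [stationaryPart]
    rw [← integral_sub ((integrableOn_exp_neg_Ioi 0).smul_const _) (h.integrableOn h0 hx t)]
    simp only [smul_sub, sub_sub_cancel]
  -- Indicators turn the substitution `b = t - a` into the invariance of Lebesgue measure on the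
  -- whole line.
  have hind : ∀ t a : ℝ, (Set.Ioi (0 : ℝ)).indicator (fun a => Real.exp (-a) • x (t - a)) a =
      Real.exp (-t) • (Set.Iio t).indicator F (t - a) := by
    intro t a
    by_cases ha : 0 < a
    · rw [Set.indicator_of_mem (show a ∈ Set.Ioi 0 from ha),
        Set.indicator_of_mem (show t - a ∈ Set.Iio t by simpa using ha)]
      simp only [F]
      rw [smul_smul, ← Real.exp_add]
      congr 2; ring
    · rw [Set.indicator_of_notMem (show a ∉ Set.Ioi 0 from ha),
        Set.indicator_of_notMem (show t - a ∉ Set.Iio t by simpa using ha), smul_zero]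
  have hFi : ∀ t, IntegrableOn F (Set.Iic t) := by
    intro t
    have h1 := (integrable_indicator_iff measurableSet_Ioi).2 (hint1 t)
    rw [funext (hind t)] at h1
    rw [integrable_fun_smul_iff (Real.exp_pos _).ne'] at h1
    have h2 := (integrable_comp_sub_left (fun b => (Set.Iio t).indicator F b) t).1 h1
    rw [integrableOn_Iic_iff_integrableOn_Iio]
    exact (integrable_indicator_iff measurableSet_Iio).1 h2
  have hy2 : ∀ t, x t - stationaryPart x t =
      Real.exp (-t) • ((∫ b in Set.Iic 0, F b) + ∫ b in (0 : ℝ)..t, F b) := by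
    intro t
    rw [hy1, ← integral_indicator measurableSet_Ioi]
    rw [funext (hind t), integral_smul, integral_sub_left_eq_self (fun b => (Set.Iio t).indicator F b),
      integral_indicator measurableSet_Iio, ← integral_Iic_eq_integral_Iio,
      ← intervalIntegral.integral_Iic_sub_Iic (hFi 0) (hFi t), add_sub_cancel]
  have hder : ∀ t, HasDerivAt (fun t => x t - stationaryPart x t) (stationaryPart x t) t := by
    intro t
    have h1 : HasDerivAt (fun t : ℝ => (∫ b in Set.Iic 0, F b) + ∫ b in (0 : ℝ)..t, F b) (F t) t :=
      (hFc.integral_hasStrictDerivAt 0 t).hasDerivAt.const_add _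
    have h2 : HasDerivAt (fun t : ℝ => Real.exp (-t)) (-Real.exp (-t)) t := by
      simpa using (hasDerivAt_neg t).exp
    have h3 := h2.smul h1
    have h4 : (fun t => x t - stationaryPart x t) = fun t =>
      Real.exp (-t) • ((∫ b in Set.Iic 0, F b) + ∫ b in (0 : ℝ)..t, F b) := funext hy2
    rw [h4]
    refine h3.congr_deriv ?_
    rw [neg_smul, ← hy2 t]
    simp only [F]
    rw [smul_smul, ← Real.exp_add, neg_add_cancel, Real.exp_zero, one_smul]
    abel
  rw [intervalIntegral.integral_eq_sub_of_hasDerivAt (fun τ _ => hder τ)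
    ((h.continuous_stationaryPart h0 hx).intervalIntegrable _ _), h0]
  abel

theorem intervalIntegral_integral_exp_mul {ν : Measure ℝ} [IsFiniteMeasure ν] {f : ℝ → ℂ}
    (hf : Integrable f ν) (t : ℝ) :
    ∫ τ in (0 : ℝ)..t, ∫ u, Complex.exp (Complex.I * τ * u) * f u ∂ν = ∫ u, e t u * f u ∂ν := by
  have : IsFiniteMeasure (volume.restrict (Set.uIoc 0 t)) := by
    unfold Set.uIoc; infer_instance
  have hint : Integrable (Function.uncurry fun (τ u : ℝ) => Complex.exp (Complex.I * τ * u) * f u)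
      ((volume.restrict (Set.uIoc 0 t)).prod ν) := by
    have h1 : Integrable (fun p : ℝ × ℝ => (1 : ℂ) * f p.2)
        ((volume.restrict (Set.uIoc 0 t)).prod ν) :=
      (integrable_const (1 : ℂ)).mul_prod hf
    refine h1.mono ?_ (ae_of_all _ fun p => ?_)
    · have h2 : AEStronglyMeasurable (fun p : ℝ × ℝ => f p.2)
        ((volume.restrict (Set.uIoc 0 t)).prod ν) := by simpa using h1.1
      exact AEStronglyMeasurable.mul (Continuous.aestronglyMeasurable (by fun_prop)) h2
    · simp only [Function.uncurry]
      rw [norm_mul, norm_exp_I_mul, norm_mul, norm_one]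
  simp_rw [e_eq_integral]
  rw [intervalIntegral_integral_swap hint]
  simp_rw [intervalIntegral.integral_mul_const]

/-- Here `conj f` plays the role of `w` in `L²(ν)`. The lemma is used with `w` a value of the
stationary part and then with `w` a value of `x`, which replaces the construction of a spectral
isomorphism. -/
theorem HasStationaryIncrements.inner_eq_integral (h : HasStationaryIncrements x)
    (h0 : x 0 = 0) (hx : Continuous x) {ν : Measure ℝ} [IsFiniteMeasure ν] {w : H} {f : ℝ → ℂ}
    (hf : Integrable f ν)
    (hw : ∀ τ, ⟪w, stationaryPart x τ⟫_ℂ = ∫ u, Complex.exp (Complex.I * τ * u) * f u ∂ν) (t : ℝ) :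
    ⟪w, x t⟫_ℂ = ∫ u, e t u * (1 + Complex.I * u) * f u ∂ν := by
  have hz := h.continuous_stationaryPart h0 hx
  have h1 : ⟪w, ∫ τ in (0 : ℝ)..t, stationaryPart x τ⟫_ℂ = ∫ u, e t u * f u ∂ν := by
    rw [← intervalIntegral_integral_exp_mul hf t]
    simp_rw [← hw]
    exact ((innerSL ℂ w).intervalIntegral_comp_comm (hz.intervalIntegrable _ _)).symm
  have hE : ∀ τ : ℝ, Integrable (fun u : ℝ => Complex.exp (Complex.I * τ * u) * f u) ν := fun τ =>
    hf.bdd_mul (c := 1) (Continuous.aestronglyMeasurable (by fun_prop))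
      (ae_of_all _ fun u => (norm_exp_I_mul τ u).le)
  have he : Integrable (fun u : ℝ => e t u * f u) ν :=
    hf.bdd_mul (c := |t|) (measurable_e t).aestronglyMeasurable
      (ae_of_all _ fun u => norm_e_le t u)
  rw [h.eq_stationaryPart_add_integral h0 hx t, inner_add_right, inner_sub_right, h1, hw, hw,
    ← integral_sub (hE t) (hE 0), ← integral_add (by exact (hE t).sub (hE 0)) he]
  refine integral_congr_ae (ae_of_all _ fun u => ?_)
  simp only
  rw [mul_add, e_mul_self]
  simp
  ring

theorem HasStationaryIncrements.exists_spectral_measure (h : HasStationaryIncrements x)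
    (h0 : x 0 = 0) (hx : Continuous x) :
    ∃ σ : Measure ℝ, FiniteCondition σ ∧ ∀ s t, ⟪x s, x t⟫_ℂ = kernelOf σ s t := by
  obtain ⟨ν, hν, hφ⟩ := exists_charFun_eq_of_inner_eq (h.continuous_stationaryPart h0 hx)
    (φ := fun t => ⟪stationaryPart x 0, stationaryPart x t⟫_ℂ)
    (h.inner_stationaryPart h0 hx)
  have hzz : ∀ s τ : ℝ, ⟪stationaryPart x s, stationaryPart x τ⟫_ℂ =
      ∫ u : ℝ, Complex.exp (Complex.I * τ * u) * conj (Complex.exp (Complex.I * s * u)) ∂ν := by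
    intro s τ
    rw [h.inner_stationaryPart h0 hx, ← congrFun hφ (τ - s), charFun_apply_real]
    refine integral_congr_ae (ae_of_all _ fun u => ?_)
    simp only
    rw [conj_exp_I_mul, ← Complex.exp_add]
    push_cast
    ring_nf
  have hEi : ∀ s : ℝ, Integrable (fun u : ℝ => conj (Complex.exp (Complex.I * s * u))) ν := fun s =>
    Integrable.of_bound (C := 1) (Continuous.aestronglyMeasurable (by fun_prop))
      (ae_of_all _ fun u => by rw [RCLike.norm_conj, norm_exp_I_mul])
  have hzx := fun s t => h.inner_eq_integral h0 hx (hEi s) (hzz s) t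
  have hxz : ∀ t τ : ℝ, ⟪x t, stationaryPart x τ⟫_ℂ =
      ∫ u : ℝ, Complex.exp (Complex.I * τ * u) * conj (e t u * (1 + Complex.I * u)) ∂ν := by
    intro t τ
    rw [← inner_conj_symm, hzx, ← integral_conj]
    refine integral_congr_ae (ae_of_all _ fun u => ?_)
    simp only [map_mul, Complex.conj_conj]
    ring
  have hfi : ∀ t : ℝ, Integrable (fun u : ℝ => conj (e t u * (1 + Complex.I * u))) ν := fun t => by
    refine Integrable.of_bound (C := |t| + 2) ?_ (ae_of_all _ fun u => ?_)
    · refine Measurable.aestronglyMeasurable ?_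
      have := measurable_e t
      fun_prop
    · rw [RCLike.norm_conj, mul_add, mul_one]
      refine (norm_add_le _ _).trans (add_le_add (norm_e_le t u) ?_)
      simpa using norm_e_mul_abs_le t u
  have hxx := fun s t => h.inner_eq_integral h0 hx (hfi s) (hxz s) t
  -- The density is `|1 + iu|²`, from the factor `1 + iu` in each argument.
  refine ⟨ν.withDensity fun u => ENNReal.ofReal (1 + u ^ 2), ?_, fun s t => ?_⟩
  · rw [FiniteCondition, lintegral_withDensity_eq_lintegral_mul _ (by fun_prop) (by fun_prop)]
    have h1 : ∀ u : ℝ, ((fun u : ℝ => ENNReal.ofReal (1 + u ^ 2)) *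
        fun u : ℝ => ENNReal.ofReal (1 / (1 + u ^ 2))) u = 1 := by
      intro u
      have hq : (0 : ℝ) < 1 + u ^ 2 := by positivity
      rw [Pi.mul_apply, ← ENNReal.ofReal_mul hq.le, mul_one_div_cancel hq.ne', ENNReal.ofReal_one]
    simp_rw [h1]
    simp
  · rw [hxx, kernelOf, integral_withDensity_eq_integral_toReal_smul (by fun_prop)
      (ae_of_all _ fun u => ENNReal.ofReal_lt_top)]
    refine integral_congr_ae (ae_of_all _ fun u => ?_)
    simp only
    rw [ENNReal.toReal_ofReal (by positivity), Complex.real_smul]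
    simp only [map_mul, map_add, map_one, Complex.conj_I, Complex.conj_ofReal]
    push_cast
    linear_combination -(e t u * conj (e s u) * u ^ 2) * Complex.I_sq

end StationaryIncrements

/-! ### Uniqueness of the spectral measure. -/

section Uniqueness

/-- For `t ≠ 0` a zero of `e t` is a nonzero multiple of `2π/t`; a common zero would make `√2`
rational. -/
theorem e_ne_zero_or (u : ℝ) : e 1 u ≠ 0 ∨ e (√2) u ≠ 0 := by
  by_contra! h
  obtain ⟨h1, h2⟩ := h
  by_cases hu : u = 0
  · simp [e, hu] at h1
  have hz : ∀ t : ℝ, e t u = 0 → ∃ n : ℤ, t * u = n * (2 * Real.pi) := by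
    intro t ht
    have h3 := e_mul_self t u
    rw [ht, zero_mul, eq_comm, sub_eq_zero, Complex.exp_eq_one_iff] at h3
    obtain ⟨n, hn⟩ := h3
    refine ⟨n, ?_⟩
    have h4 : Complex.I * ((t * u : ℝ) : ℂ) = Complex.I * ((n * (2 * Real.pi) : ℝ) : ℂ) := by
      push_cast
      linear_combination hn
    exact_mod_cast mul_left_cancel₀ Complex.I_ne_zero h4
  obtain ⟨m, hm⟩ := hz _ h1
  obtain ⟨n, hn⟩ := hz _ h2
  rw [one_mul] at hm
  have hm0 : (m : ℝ) ≠ 0 := by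
    rintro hm0
    rw [hm0, zero_mul] at hm
    exact hu hm
  refine irrational_sqrt_two ⟨(n / m : ℚ), ?_⟩
  push_cast
  rw [div_eq_iff hm0]
  rw [hm, ← mul_assoc] at hn
  exact (mul_right_cancel₀ (by positivity) hn).symm

variable {σ σ₁ σ₂ : Measure ℝ}

/-- Since `e_{t+a} - e_t = exp(itu) e_a`, multiplying by `conj e_a` gives `|e_a|² exp(itu)`. -/
theorem charFun_withDensity_enorm_e_sq
    (h : ∀ s t, Integrable (fun u => conj (e s u) * e t u) σ) (a t : ℝ) :
    charFun (σ.withDensity fun u => ‖e a u‖ₑ ^ 2) t = kernelOf σ a (t + a) - kernelOf σ a t := by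
  have hm := measurable_e a
  simp only [kernelOf]
  rw [charFun_apply_real, integral_withDensity_eq_integral_toReal_smul (by fun_prop)
    (ae_of_all _ fun u => ENNReal.pow_lt_top enorm_lt_top), ← integral_sub (h _ _) (h _ _)]
  refine integral_congr_ae (ae_of_all _ fun u => ?_)
  simp only
  rw [e_add, ENNReal.toReal_pow, toReal_enorm, Complex.real_smul, Complex.ofReal_pow,
    ← Complex.conj_mul']
  ring_nf

theorem isFiniteMeasure_withDensity_enorm_e_sq
    (h : ∀ s t, Integrable (fun u => conj (e s u) * e t u) σ) (a : ℝ) :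
    IsFiniteMeasure (σ.withDensity fun u => ‖e a u‖ₑ ^ 2) := by
  refine isFiniteMeasure_withDensity ?_
  have h1 := (h a a).2
  rw [HasFiniteIntegral] at h1
  refine ne_of_lt ?_
  convert h1 using 3 with u
  rw [enorm_mul, ← ofReal_norm, ← ofReal_norm, RCLike.norm_conj, sq]

theorem eq_of_kernelOf_eq (h₁ : ∀ s t, Integrable (fun u => conj (e s u) * e t u) σ₁)
    (h₂ : ∀ s t, Integrable (fun u => conj (e s u) * e t u) σ₂)
    (h : ∀ s t, kernelOf σ₁ s t = kernelOf σ₂ s t) : σ₁ = σ₂ := by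
  have hd : ∀ a, (σ₁.withDensity fun u => ‖e a u‖ₑ ^ 2) = σ₂.withDensity fun u => ‖e a u‖ₑ ^ 2 := by
    intro a
    have := isFiniteMeasure_withDensity_enorm_e_sq h₁ a
    have := isFiniteMeasure_withDensity_enorm_e_sq h₂ a
    refine Measure.ext_of_charFun ?_
    ext t
    rw [charFun_withDensity_enorm_e_sq h₁, charFun_withDensity_enorm_e_sq h₂, h, h]
  -- This density is nowhere zero and nowhere infinite, hence invertible.
  let g : ℝ → ENNReal := (fun u => ‖e 1 u‖ₑ ^ 2) + fun u => ‖e (√2) u‖ₑ ^ 2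
  have hm1 := measurable_e 1
  have hm2 := measurable_e (√2)
  have hg : Measurable g := by simp only [g]; fun_prop
  have hg0 : ∀ u, g u ≠ 0 := by
    intro u hu
    simp only [g, Pi.add_apply, add_eq_zero, ne_eq, OfNat.ofNat_ne_zero, not_false_eq_true,
      pow_eq_zero_iff, enorm_eq_zero] at hu
    exact (e_ne_zero_or u).elim (fun h => h hu.1) fun h => h hu.2
  have hgt : ∀ u, g u ≠ ⊤ := fun u => by simp [g]
  have hgd : σ₁.withDensity g = σ₂.withDensity g := by
    simp only [g]
    rw [withDensity_add_left (by fun_prop), withDensity_add_left (by fun_prop), hd, hd]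
  rw [← withDensity_inv_same (μ := σ₁) hg (ae_of_all _ hg0) (ae_of_all _ hgt), hgd,
    withDensity_inv_same hg (ae_of_all _ hg0) (ae_of_all _ hgt)]

end Uniqueness

/-! ### From the process to a curve in `L²`. -/

section SpectralMeasure

theorem inner_toLp {Ω : Type*} [MeasurableSpace Ω] {P : Measure Ω} {f g : Ω → ℂ}
    (hf : MemLp f 2 P) (hg : MemLp g 2 P) :
    ⟪hf.toLp, hg.toLp⟫_ℂ = ∫ ω, conj (f ω) * g ω ∂P := by
  rw [L2.inner_def]
  refine integral_congr_ae ?_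
  filter_upwards [hf.coeFn_toLp, hg.coeFn_toLp] with ω h1 h2
  rw [h1, h2, RCLike.inner_apply, mul_comm]

variable {Ω : Type*} [MeasurableSpace Ω] {P : Measure Ω} {X : ℝ → Ω → ℂ}

theorem IsAdmissibleProcess.memLp (h : IsAdmissibleProcess P X) (t : ℝ) : MemLp (X t) 2 P :=
  (h.gaussian.hasGaussianLaw_eval t).memLp_two

/-- The hypothesis on the process compares increments with a common base point. Differences of two
such increments give arbitrary ones, and sesquilinearity extends the invariance. -/
theorem IsAdmissibleProcess.hasStationaryIncrements (h : IsAdmissibleProcess P X) :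
    HasStationaryIncrements fun t => (h.memLp t).toLp := by
  have hA : ∀ g s t, ⟪(h.memLp (g + s)).toLp - (h.memLp (g + 0)).toLp,
      (h.memLp (g + t)).toLp - (h.memLp (g + 0)).toLp⟫_ℂ =
      ⟪(h.memLp s).toLp - (h.memLp 0).toLp, (h.memLp t).toLp - (h.memLp 0).toLp⟫_ℂ := by
    intro g s t
    simp only [← MemLp.toLp_sub]
    rw [inner_toLp, inner_toLp]
    exact h.stationary 0 g s t
  intro g p q p' q'
  have hs : ∀ s t : ℝ, (h.memLp s).toLp - (h.memLp t).toLp = ((h.memLp s).toLp - (h.memLp 0).toLp) -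
    ((h.memLp t).toLp - (h.memLp 0).toLp) := fun s t => by abel
  have hs' : ∀ s t : ℝ, (h.memLp s).toLp - (h.memLp t).toLp =
    ((h.memLp s).toLp - (h.memLp (g + 0)).toLp) -
    ((h.memLp t).toLp - (h.memLp (g + 0)).toLp) := fun s t => by abel
  simp only
  rw [hs p q, hs p' q', hs' (g + p), hs' (g + p')]
  simp only [inner_sub_left _ ((h.memLp _).toLp - (h.memLp _).toLp)
    ((h.memLp _).toLp - (h.memLp _).toLp), inner_sub_right _ ((h.memLp _).toLp - (h.memLp _).toLp)
    ((h.memLp _).toLp - (h.memLp _).toLp), hA]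

theorem IsAdmissibleProcess.toLp_zero (h : IsAdmissibleProcess P X) : (h.memLp 0).toLp = 0 := by
  rw [Lp.eq_zero_iff_ae_eq_zero]
  exact (h.memLp 0).coeFn_toLp.trans h.zero

/-- Because `‖x_s - x_t‖ = ‖x_{s-t}‖`, continuity of the norm at `0`, where `x` vanishes, suffices.
-/
theorem IsAdmissibleProcess.continuous_toLp (h : IsAdmissibleProcess P X) :
    Continuous fun t => (h.memLp t).toLp := by
  have hn : ∀ t, ‖(h.memLp t).toLp‖ = √(∫ ω, ‖X t ω‖ ^ 2 ∂P) := by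
    intro t
    rw [norm_eq_sqrt_re_inner (𝕜 := ℂ), inner_toLp]
    simp only [Complex.conj_mul']
    norm_cast
  have hc : Continuous fun t => ‖(h.memLp t).toLp‖ := by
    simp_rw [hn]; exact h.continuous.sqrt
  refine continuous_iff_continuousAt.2 fun t => ?_
  rw [ContinuousAt, tendsto_iff_norm_sub_tendsto_zero]
  have h1 : ∀ s, ‖(h.memLp s).toLp - (h.memLp t).toLp‖ = ‖(h.memLp (s - t)).toLp‖ := by
    intro s
    have := h.hasStationaryIncrements.norm_sub h.toLp_zero t (s - t)
    simpa using this
  simp_rw [h1]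
  have h2 : Continuous fun s => ‖(h.memLp (s - t)).toLp‖ := hc.comp (by fun_prop)
  have h3 := h2.tendsto t
  simp only [sub_self] at h3
  rwa [h.toLp_zero, norm_zero] at h3

theorem IsAdmissibleProcess.exists_isSpectralMeasure (h : IsAdmissibleProcess P X) :
    ∃ σ : Measure ℝ, FiniteCondition σ ∧ IsSpectralMeasure P X σ := by
  obtain ⟨σ, hσ, hk⟩ := h.hasStationaryIncrements.exists_spectral_measure h.toLp_zero
    h.continuous_toLp
  refine ⟨σ, hσ, fun s t => ⟨hσ.integrable_e s t, ?_⟩⟩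
  rw [← hk, inner_toLp]
  rfl

theorem IsSpectralMeasure.unique {σ₁ σ₂ : Measure ℝ} (h₁ : IsSpectralMeasure P X σ₁)
    (h₂ : IsSpectralMeasure P X σ₂) : σ₁ = σ₂ :=
  eq_of_kernelOf_eq (fun s t => (h₁ s t).1) (fun s t => (h₂ s t).1) fun s t =>
    (h₁ s t).2.symm.trans (h₂ s t).2

end SpectralMeasure

/-! ### Centered Gaussian variables as a closed subset of `L²`. -/

section CenteredGaussian

variable {Ω : Type*} [MeasurableSpace Ω] {P : Measure Ω}

theorem continuous_integral_L2 {𝕜 : Type*} [RCLike 𝕜] [IsFiniteMeasure P] :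
    Continuous fun f : Lp 𝕜 2 P => ∫ ω, f ω ∂P := by
  have h : ∀ f : Lp 𝕜 2 P, ∫ ω, f ω ∂P =
      ⟪indicatorConstLp 2 MeasurableSet.univ (measure_ne_top P _) (1 : 𝕜), f⟫_𝕜 := by
    intro f
    rw [L2.inner_indicatorConstLp_one, setIntegral_univ]
  simp_rw [h]
  fun_prop

theorem norm_exp_mul_I_sub_le (x y : ℝ) :
    ‖Complex.exp (x * Complex.I) - Complex.exp (y * Complex.I)‖ ≤ |x - y| := by
  have h1 : Complex.exp (x * Complex.I) - Complex.exp (y * Complex.I) =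
      Complex.exp (y * Complex.I) * (e (x - y) 1 * (Complex.I * (1 : ℝ))) := by
    rw [e_mul_self, mul_sub, ← Complex.exp_add]
    push_cast
    ring_nf
  rw [h1, norm_mul, Complex.norm_exp_ofReal_mul_I, one_mul, norm_mul]
  simpa using norm_e_le (x - y) 1

theorem continuous_integral_exp [IsProbabilityMeasure P] :
    Continuous fun f : Lp ℝ 2 P => ∫ ω, Complex.exp (f ω * Complex.I) ∂P := by
  -- Subtracting `1` makes the function vanish at `0`, so composition with it acts continuously on
  -- `L²`.
  have hlip : LipschitzWith 1 fun x : ℝ => Complex.exp (x * Complex.I) - 1 := by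
    refine LipschitzWith.of_dist_le_mul fun x y => ?_
    rw [dist_sub_right, dist_eq_norm, NNReal.coe_one, one_mul, Real.dist_eq]
    exact norm_exp_mul_I_sub_le x y
  have h0 : (fun x : ℝ => Complex.exp (x * Complex.I) - 1) 0 = 0 := by simp
  have h : ∀ f : Lp ℝ 2 P, ∫ ω, Complex.exp (f ω * Complex.I) ∂P =
      (∫ ω, hlip.compLp h0 f ω ∂P) + 1 := by
    intro f
    rw [integral_congr_ae (hlip.coeFn_compLp h0 f)]
    have hi : Integrable (fun ω => Complex.exp (f ω * Complex.I)) P := by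
      refine Integrable.of_bound (C := 1) ?_
        (ae_of_all _ fun ω => (Complex.norm_exp_ofReal_mul_I _).le)
      have hc : Continuous fun x : ℝ => Complex.exp (x * Complex.I) := by fun_prop
      exact hc.comp_aestronglyMeasurable (Lp.aestronglyMeasurable f)
    simp only [Function.comp_def]
    rw [integral_sub hi (integrable_const 1)]
    simp
  simp_rw [h]
  exact (continuous_integral_L2.comp (hlip.continuous_compLp h0)).add continuous_const

/-- The square integrable real random variables with a centered Gaussian law, characterized by
their characteristic function at `1`. -/
def centeredGaussian (P : Measure Ω) : Set (Lp ℝ 2 P) :=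
  {f | ∫ ω, f ω ∂P = 0 ∧
    ∫ ω, Complex.exp (f ω * Complex.I) ∂P = Complex.exp (-((‖f‖ ^ 2 : ℝ) : ℂ) / 2)}

/-- Closedness passes from finite combinations of independent Gaussians to `L²` limits. The
characteristic function at `1` suffices later, since the vectors tested there run through a whole
linear space. -/
theorem isClosed_centeredGaussian [IsProbabilityMeasure P] : IsClosed (centeredGaussian P) :=
  (isClosed_eq continuous_integral_L2 continuous_const).inter
    (isClosed_eq continuous_integral_exp (by fun_prop))

theorem norm_sq_Lp_eq_integral (f : Lp ℝ 2 P) : ‖f‖ ^ 2 = ∫ ω, f ω ^ 2 ∂P := by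
  rw [← real_inner_self_eq_norm_sq, L2.inner_def]
  simp [sq]

theorem variance_eq_norm_sq {f : Lp ℝ 2 P} (hf : ∫ ω, f ω ∂P = 0) : Var[f; P] = ‖f‖ ^ 2 := by
  rw [variance_of_integral_eq_zero (Lp.aestronglyMeasurable f).aemeasurable hf,
    norm_sq_Lp_eq_integral]

theorem mem_centeredGaussian {f : Lp ℝ 2 P} (h : HasGaussianLaw f P) (h0 : ∫ ω, f ω ∂P = 0) :
    f ∈ centeredGaussian P := by
  refine ⟨h0, ?_⟩
  have h1 := h.charFun_map_eq 1
  rw [charFun_apply_real, integral_map h.aemeasurable (by fun_prop)] at h1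
  have h2 : ∀ x : ℝ, ⟪(1 : ℝ), x⟫_ℝ = x := fun x => by simp
  simp only [h2, Complex.ofReal_one, one_mul] at h1
  rw [h1, h0, variance_eq_norm_sq h0]
  simp [neg_div]

end CenteredGaussian

/-! ### Isometric embedding into Gaussian variables. -/

section GaussianIsometry

/-- Taking real parts, as a continuous real linear map between `L²` spaces. -/
noncomputable def reLp {Ω : Type*} [MeasurableSpace Ω] (P : Measure Ω) :
    Lp ℂ 2 P →L[ℝ] Lp ℝ 2 P :=
  Complex.reCLM.compLpL 2 P

theorem coeFn_reLp {Ω : Type*} [MeasurableSpace Ω] {P : Measure Ω} (f : Lp ℂ 2 P) :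
    reLp P f =ᵐ[P] fun ω => (f ω).re :=
  ContinuousLinearMap.coeFn_compLpL (p := 2) (μ := P) Complex.reCLM f

variable {Ω ι : Type*} [MeasurableSpace Ω] {P : Measure Ω}

theorem orthonormal_toLp_of_iIndepFun {ξ : ι → Ω → ℝ}
    (hlaw : ∀ i, HasLaw (ξ i) (gaussianReal 0 1) P) (hind : iIndepFun ξ P)
    (hξ : ∀ i, MemLp (fun ω => (ξ i ω : ℂ)) 2 P) :
    Orthonormal ℂ fun i => (hξ i).toLp := by
  classical
  rw [orthonormal_iff_ite]
  intro i j
  have h0 : ∀ i, ∫ ω, ξ i ω ∂P = 0 := fun i => by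
    rw [(hlaw i).integral_eq, integral_id_gaussianReal]
  have h1 : ⟪(hξ i).toLp, (hξ j).toLp⟫_ℂ = ((∫ ω, ξ i ω * ξ j ω ∂P : ℝ) : ℂ) := by
    rw [inner_toLp, ← integral_complex_ofReal]
    refine integral_congr_ae (ae_of_all _ fun ω => ?_)
    simp
  rw [h1]
  split_ifs with hij
  · subst hij
    have h2 := variance_of_integral_eq_zero (hlaw i).aemeasurable (h0 i)
    rw [(hlaw i).variance_eq, variance_id_gaussianReal] at h2
    simp_rw [← sq, ← h2]
    simp
  · rw [(hind.indepFun hij).integral_fun_mul_eq_mul_integral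
      (hlaw i).aemeasurable.aestronglyMeasurable (hlaw j).aemeasurable.aestronglyMeasurable, h0]
    simp

theorem sum_smul_mem_centeredGaussian {ξ : ι → Ω → ℝ}
    (hlaw : ∀ i, HasLaw (ξ i) (gaussianReal 0 1) P) (hind : iIndepFun ξ P)
    {f : ι → Lp ℝ 2 P} (hf : ∀ i, f i =ᵐ[P] ξ i) (s : Finset ι) (c : ι → ℝ) :
    ∑ i ∈ s, c i • f i ∈ centeredGaussian P := by
  have hG : HasGaussianLaw (fun ω => fun i : s => ξ i ω) P :=
    iIndepFun.hasGaussianLaw (X := fun (i : s) => ξ i) (fun i => (hlaw i).hasGaussianLaw)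
      (hind.precomp Subtype.val_injective)
  have h1 : HasGaussianLaw (fun ω => ∑ i : s, c i * ξ i ω) P := by
    have := hG.map_fun (∑ i : s, c i • ContinuousLinearMap.proj (R := ℝ) (φ := fun _ : s => ℝ) i)
    refine this.congr (ae_of_all _ fun ω => ?_)
    simp
  have h2 : ⇑(∑ i ∈ s, c i • f i) =ᵐ[P] fun ω => ∑ i : s, c i * ξ i ω := by
    have h3 : ∀ i : s, ⇑(c i • f i) =ᵐ[P] fun ω => c i * ξ i ω := by
      intro i
      filter_upwards [Lp.coeFn_smul (c i) (f i), hf i] with ω h4 h5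
      rw [h4, Pi.smul_apply, h5, smul_eq_mul]
    rw [← Finset.sum_coe_sort]
    filter_upwards [Lp.coeFn_finsetSum Finset.univ fun i : s => c i • f i,
      ae_all_iff.2 h3] with ω h4 h5
    rw [h4, Finset.sum_apply]
    exact Finset.sum_congr rfl fun i _ => h5 i
  refine mem_centeredGaussian (h1.congr h2.symm) ?_
  rw [integral_congr_ae h2, integral_finsetSum]
  · refine Finset.sum_eq_zero fun i _ => ?_
    rw [integral_const_mul, (hlaw i).integral_eq, integral_id_gaussianReal, mul_zero]
  · exact fun i _ => ((hlaw i).hasGaussianLaw.integrable).const_mul _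

end GaussianIsometry

/-- Every Hilbert space embeds isometrically into a space of Gaussian random variables. -/
theorem exists_gaussian_isometry (H : Type) [NormedAddCommGroup H] [InnerProductSpace ℂ H]
    [CompleteSpace H] :
    ∃ (Ω : Type u) (_ : MeasurableSpace Ω) (P : Measure Ω) (_ : IsProbabilityMeasure P)
      (T : H →ₗᵢ[ℂ] Lp ℂ 2 P), ∀ a, reLp P (T a) ∈ centeredGaussian P := by
  classical
  obtain ⟨w, b, -⟩ := exists_hilbertBasis ℂ H
  -- `ULift` places the sample space in the universe `u`.
  obtain ⟨Ω, mΩ, P, ξ', -, hlaw', hind', hP⟩ := exists_iid (ULift.{u} w) (gaussianReal 0 1)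
  let ξ : w → Ω → ℝ := fun i => ξ' ⟨i⟩
  have hlaw : ∀ i, HasLaw (ξ i) (gaussianReal 0 1) P := fun i => hlaw' ⟨i⟩
  have hind : iIndepFun ξ P := hind'.precomp (g := ULift.up) ULift.up_injective
  have hξ : ∀ i, MemLp (fun ω => (ξ i ω : ℂ)) 2 P := fun i =>
    (hlaw i).hasGaussianLaw.memLp_two.ofReal
  have hon := orthonormal_toLp_of_iIndepFun hlaw hind hξ
  let T : H →ₗᵢ[ℂ] Lp ℂ 2 P :=
    hon.orthogonalFamily.linearIsometry.comp b.repr.toLinearIsometry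
  have hT : ∀ i, T (b i) = (hξ i).toLp := by
    intro i
    have h1 : T (b i) = hon.orthogonalFamily.linearIsometry (b.repr (b i)) := rfl
    rw [h1, b.repr_self]
    refine (hon.orthogonalFamily.linearIsometry_apply_single (1 : ℂ)).trans ?_
    simp
  let f : w → Lp ℝ 2 P := fun i => reLp P ((hξ i).toLp)
  have hf : ∀ i, f i =ᵐ[P] ξ i := by
    intro i
    filter_upwards [coeFn_reLp ((hξ i).toLp), (hξ i).coeFn_toLp] with ω h1 h2
    rw [h1, h2, Complex.ofReal_re]
  -- The `ξ i` are real, so the real part of a complex combination is a real combination of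
  -- independent Gaussians.
  have hre : ∀ (c : ℂ) i, reLp P (T (c • b i)) = c.re • f i := by
    intro c i
    rw [map_smul, hT]
    refine Lp.ext ?_
    filter_upwards [coeFn_reLp (c • (hξ i).toLp), Lp.coeFn_smul c ((hξ i).toLp),
      (hξ i).coeFn_toLp, Lp.coeFn_smul c.re (f i), hf i] with ω h1 h2 h3 h4 h5
    rw [h1, h2, Pi.smul_apply, h3, h4, Pi.smul_apply, h5]
    simp
  refine ⟨Ω, mΩ, P, hP, T, fun a => ?_⟩
  have hs := (((b.hasSum_repr a).mapL T.toContinuousLinearMap).mapL (reLp P))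
  refine isClosed_centeredGaussian.mem_of_tendsto hs (Eventually.of_forall fun s => ?_)
  have h1 : ∀ i, reLp P (T.toContinuousLinearMap (b.repr a i • b i)) = (b.repr a i).re • f i :=
    fun i => hre _ i
  simp_rw [h1]
  exact sum_smul_mem_centeredGaussian hlaw hind hf s _

/-- In one coordinate, `L z = Re((L 1 - i L i) z)`. Thus a real functional of the values `T (a i)`
is the real part of `T` at one vector, by complex linearity. -/
theorem exists_dual_eq_sum_re {ι : Type*} [Fintype ι] (L : StrongDual ℝ (ι → ℂ)) :
    ∃ d : ι → ℂ, ∀ z, L z = ∑ i, (d i * z i).re := by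
  classical
  refine ⟨fun i => L (Pi.single i 1) - Complex.I * L (Pi.single i Complex.I), fun z => ?_⟩
  have h1 : ∀ i, Pi.single (M := fun _ : ι => ℂ) i (z i) =
      (z i).re • Pi.single (M := fun _ : ι => ℂ) i 1 +
        (z i).im • Pi.single (M := fun _ : ι => ℂ) i Complex.I := by
    intro i
    rw [← Pi.single_smul, ← Pi.single_smul, ← Pi.single_add]
    congr 1
    simp [Complex.re_add_im]
  conv_lhs => rw [← Finset.univ_sum_single z, map_sum]
  refine Finset.sum_congr rfl fun i _ => ?_
  rw [h1, map_add, map_smul, map_smul]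
  simp
  ring

section SpectralMeasure

variable {Ω : Type*} [MeasurableSpace Ω] {P : Measure Ω}
  {H : Type*} [NormedAddCommGroup H] [InnerProductSpace ℂ H] {T : H →ₗᵢ[ℂ] Lp ℂ 2 P}

theorem integral_conj_sub_mul_sub (a b c d : H) :
    ∫ ω, conj (T a ω - T b ω) * (T c ω - T d ω) ∂P = ⟪a - b, c - d⟫_ℂ := by
  rw [← T.inner_map_map, map_sub, map_sub, L2.inner_def]
  refine integral_congr_ae ?_
  filter_upwards [Lp.coeFn_sub (T a) (T b), Lp.coeFn_sub (T c) (T d)] with ω h1 h2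
  rw [h1, h2, RCLike.inner_apply, mul_comm]
  rfl

variable [IsProbabilityMeasure P]

theorem isGaussianProcess_of_mem_centeredGaussian
    (hT : ∀ a, reLp P (T a) ∈ centeredGaussian P) {S : Type*} (a : S → H) :
    IsGaussianProcess (fun t ω => T (a t) ω) P where
  hasGaussianLaw I := by
    have hmeas : AEMeasurable (fun ω => I.restrict fun t => T (a t) ω) P :=
      aemeasurable_pi_lambda _ fun i => (Lp.aestronglyMeasurable (T (a i))).aemeasurable
    refine (hasGaussianLaw_iff_charFunDual_map_eq hmeas).2 fun L => ?_
    obtain ⟨d, hd⟩ := exists_dual_eq_sum_re L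
    obtain ⟨h0, h1⟩ := hT (∑ i : I, d i • a i)
    have hL : L ∘ (fun ω => I.restrict fun t => T (a t) ω) =ᵐ[P]
        reLp P (T (∑ i : I, d i • a i)) := by
      rw [map_sum]
      simp_rw [map_smul]
      have h2 : ∀ i : I, ⇑(d i • T (a i)) =ᵐ[P] d i • ⇑(T (a i)) := fun i => Lp.coeFn_smul _ _
      filter_upwards [coeFn_reLp (∑ i : I, d i • T (a i)),
        Lp.coeFn_finsetSum Finset.univ fun i : I => d i • T (a i), ae_all_iff.2 h2]
        with ω h3 h4 h5
      rw [h3, h4, Finset.sum_apply, Complex.re_sum, Function.comp_apply, hd]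
      refine Finset.sum_congr rfl fun i _ => ?_
      rw [h5]
      rfl
    rw [charFunDual_apply, integral_map hmeas (by fun_prop), integral_congr_ae hL,
      variance_congr hL, h0, variance_eq_norm_sq h0]
    have h6 : ∫ ω, Complex.exp (L (I.restrict fun t => T (a t) ω) * Complex.I) ∂P =
        ∫ ω, Complex.exp (reLp P (T (∑ i : I, d i • a i)) ω * Complex.I) ∂P := by
      refine integral_congr_ae ?_
      filter_upwards [hL] with ω hω
      rw [← hω, Function.comp_apply]
    rw [h6, h1]
    simp [neg_div]

theorem integral_eq_zero_of_mem_centeredGaussian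
    (hT : ∀ a, reLp P (T a) ∈ centeredGaussian P) (a : H) : ∫ ω, T a ω ∂P = 0 := by
  have hi : Integrable (T a) P := (Lp.memLp (T a)).integrable one_le_two
  have hre : ∀ a, ∫ ω, (T a ω).re ∂P = 0 := fun a => by
    rw [← integral_congr_ae (coeFn_reLp (T a))]
    exact (hT a).1
  have him : ∫ ω, (T a ω).im ∂P = 0 := by
    -- `Im z = Re(-iz)`.
    rw [← hre (-Complex.I • a)]
    refine integral_congr_ae ?_
    rw [map_smul]
    filter_upwards [Lp.coeFn_smul (-Complex.I) (T a)] with ω h1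
    rw [h1]
    simp
  apply Complex.ext
  · rw [Complex.zero_re, ← hre a]
    exact (integral_re (𝕜 := ℂ) hi).symm
  · rw [Complex.zero_im, ← him]
    exact (integral_im (𝕜 := ℂ) hi).symm

end SpectralMeasure

/-! ### Construction of the process and conclusion. -/

theorem FiniteCondition.exists_process {σ : Measure ℝ} (h : FiniteCondition σ) :
    ∃ (Ω : Type u) (_ : MeasurableSpace Ω) (P : Measure Ω) (_ : IsProbabilityMeasure P)
      (X : ℝ → Ω → ℂ), IsAdmissibleProcess P X ∧ IsSpectralMeasure P X σ := by
  obtain ⟨Ω, mΩ, P, hP, T, hT⟩ := exists_gaussian_isometry.{u} (Lp ℂ 2 σ)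
  let a : ℝ → Lp ℂ 2 σ := fun t => (h.memLp_e t).toLp
  have ha0 : a 0 = 0 := by
    rw [Lp.eq_zero_iff_ae_eq_zero]
    filter_upwards [(h.memLp_e 0).coeFn_toLp] with u hu
    rw [hu, e_zero]
    rfl
  have hcov : ∀ s t, cov P (fun t ω => T (a t) ω) s t = kernelOf σ s t := by
    intro s t
    have h1 : ⟪a s, a t⟫_ℂ = kernelOf σ s t := inner_toLp (h.memLp_e s) (h.memLp_e t)
    rw [← h1, ← T.inner_map_map, L2.inner_def]
    refine integral_congr_ae (ae_of_all _ fun ω => ?_)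
    simp only [RCLike.inner_apply]
    rw [mul_comm]
  refine ⟨Ω, mΩ, P, hP, fun t ω => T (a t) ω, ⟨?_, ?_, ?_, ?_, ?_, ?_⟩, fun s t =>
    ⟨h.integrable_e s t, hcov s t⟩⟩
  · exact fun t => (Lp.stronglyMeasurable _).measurable
  · exact isGaussianProcess_of_mem_centeredGaussian hT a
  · exact fun t => integral_eq_zero_of_mem_centeredGaussian hT (a t)
  · rw [ha0, map_zero]
    exact Lp.coeFn_zero _ _ _
  -- A time shift by `g` multiplies the increment `e_t - e_{t₀}` by the unimodular `exp(igu)`, which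
  -- cancels in the inner product.
  · intro t₀ g s t
    rw [integral_conj_sub_mul_sub, integral_conj_sub_mul_sub]
    simp only [a, ← MemLp.toLp_sub]
    rw [inner_toLp, inner_toLp]
    refine integral_congr_ae (ae_of_all _ fun u => ?_)
    simp only [Pi.sub_apply]
    rw [e_add, e_add, e_add, add_sub_add_left_eq_sub, add_sub_add_left_eq_sub, ← mul_sub,
      ← mul_sub, map_mul]
    linear_combination (conj (e s u - e t₀ u) * (e t u - e t₀ u)) * conj_exp_I_mul_self g u
  · have h1 : ∀ t, ∫ ω, ‖T (a t) ω‖ ^ 2 ∂P = ∫ u, ‖e t u‖ ^ 2 ∂σ := by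
      intro t
      have h2 := hcov t t
      simp only [cov, kernelOf, Complex.conj_mul'] at h2
      exact_mod_cast h2
    simp_rw [h1]
    exact h.continuous_integral_norm_e_sq

end LevyKhintchine

theorem mainTheorem10 :
    -- existence and uniqueness of the spectral measure
    (∀ (Ω : Type u) [MeasurableSpace Ω] (P : Measure Ω) [IsProbabilityMeasure P]
      (X : ℝ → Ω → ℂ), LevyKhintchine.IsAdmissibleProcess P X →
        ∃! σ : Measure ℝ, LevyKhintchine.IsSpectralMeasure P X σ) ∧
    -- the measures that occur
    (∀ σ : Measure ℝ,
      (∃ (Ω : Type u) (_ : MeasurableSpace Ω) (P : Measure Ω) (_ : IsProbabilityMeasure P)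
        (X : ℝ → Ω → ℂ),
        LevyKhintchine.IsAdmissibleProcess P X ∧ LevyKhintchine.IsSpectralMeasure P X σ) ↔
      LevyKhintchine.FiniteCondition σ) ∧
    -- the negative definite function `r`
    (∀ σ : Measure ℝ, LevyKhintchine.FiniteCondition σ →
      (∀ t : ℝ, Integrable (LevyKhintchine.rIntegrand t) σ) ∧
      Continuous (LevyKhintchine.r σ) ∧
      LevyKhintchine.IsNegDefFun (LevyKhintchine.r σ) ∧
      LevyKhintchine.SatisfiesRelation σ (LevyKhintchine.r σ) ∧
      ∀ ρ : ℝ → ℂ, Continuous ρ → LevyKhintchine.IsNegDefFun ρ →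
        LevyKhintchine.SatisfiesRelation σ ρ →
        ∃ μ : ℝ, ∀ t : ℝ, ρ t = LevyKhintchine.r σ t + Complex.I * t * μ) := by
  refine ⟨fun Ω _ P _ X hX => ?_, fun σ => ⟨?_, fun h => h.exists_process⟩, fun σ h =>
    ⟨h.integrable_rIntegrand, h.continuous_r, h.isNegDefFun_r, h.satisfiesRelation_r,
      fun ρ hρ _ hrel => h.satisfiesRelation_r.exists_eq_add hrel h.continuous_r hρ⟩⟩
  · obtain ⟨σ, -, hσ⟩ := hX.exists_isSpectralMeasure
    exact ⟨σ, hσ, fun σ' hσ' => hσ'.unique hσ⟩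
  -- Finiteness is known for the spectral measure that Bochner's theorem yields; uniqueness
  -- transfers it to `σ`.
  · rintro ⟨Ω, _, P, _, X, hX, hσ⟩
    obtain ⟨σ', hfin, hσ'⟩ := hX.exists_isSpectralMeasure
    rwa [hσ.unique hσ']
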